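/- Let $\mathcal M$ and $\mathcal W$ be finite non-empty sets of men and women, and let $N=\min(|\mathcal M|,|\mathcal W|)$. Preference lists are complete: everyone finds every person of the opposite sex acceptable. Each man $m$ assigns a positive popularity $\mathcal D_m(w)$ to every woman $w$, and each woman $w$ assigns a positive popularity $\mathcal D_w(m)$ to every man $m$. Independently of the others, each person draws a strict preference list from their popularities by sampling without replacement: first the favourite partner is drawn with probability proportional to popularity, then the second favourite is drawn in the same way among the remaining candidates, and so on down to the least favourite. In a matching, each person is either single or matched with one person of the opposite sex. A matching $\mu$ is stable if there are no man $m$ and woman $w$ such that $w$ prefers $m$ to her situation in $\mu$ and $m$ prefers $w$ to his situation in $\mu$ (being single is worse than having any partner). A stable husband of $w$ is a man matched with $w$ in at least one stable matching. Denote \[ R_{\mathcal M} = \max_{m\in \mathcal M,\; w_0,w_1 \in \mathcal W} \frac{\mathcal D_m(w_0)}{\mathcal D_m(w_1)}, \qquad Q_{\mathcal W} = \max_{w_0,w_1 \in \mathcal W,\; m_0,m_1\in \mathcal M} \frac{\mathcal D_{w_0}(m_0)}{\mathcal D_{w_0}(m_1)} \cdot \frac{\mathcal D_{w_1}(m_1)}{\mathcal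 D_{w_1}(m_0)} . \] Let $w$ be a woman. Then, with probability at least $1-\frac{2}{N^2}$, every two stable husbands $m_0,m_1$ of $w$ satisfy \[ \frac{\mathcal D_w(m_0)}{\mathcal D_w(m_1)} \le \left(N^5\cdot Q_{\mathcal W}\right)^{1+\frac{4\ln (N)\,(1+\log_2 (N))}{\ln(1+1/R_{\mathcal M})}} . \] -/

import Mathlib

open MeasureTheory

/-- Popularities: a positive weight for every potential partner (everybody is acceptable).
Only the ratios of the weights matter, so they need not be scaled to sum to `1`. -/
structure Popularity (α : Type*) where
  val : α → ℝ
  pos : ∀ a, 0 < val a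

instance {α : Type*} : CoeFun (Popularity α) (fun _ => α → ℝ) := ⟨Popularity.val⟩

/-- A strict preference list of the elements of `S`, favourite first. -/
def PrefList {α : Type*} (S : Finset α) : Type _ :=
  {l : List α // l.Nodup ∧ ∀ a, a ∈ l ↔ a ∈ S}

instance {α : Type*} (S : Finset α) : MeasurableSpace (PrefList S) := ⊤

/-- `a` is ranked strictly before `b`. -/
def PrefList.Before {α : Type*} [DecidableEq α] {S : Finset α} (l : PrefList S) (a b : α) : Prop :=
  l.1.idxOf a < l.1.idxOf b

/-- The preference list consisting of `a` followed by a preference list of the other elements. -/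
def PrefList.cons {α : Type*} [DecidableEq α] {S : Finset α} (a : S)
    (l : PrefList (S.erase a.1)) : PrefList S :=
  ⟨a.1 :: l.1, by
    refine ⟨List.nodup_cons.2 ⟨fun h => by simpa using (l.2.2 _).1 h, l.2.1⟩, fun b => ?_⟩
    rw [List.mem_cons, l.2.2, Finset.mem_erase]
    constructor
    · rintro (rfl | h)
      · exact a.2
      · exact h.2
    · intro h
      by_cases hb : b = a.1
      · exact Or.inl hb
      · exact Or.inr ⟨hb, h⟩⟩

/-- One draw from the nonempty set `S`, with probabilities proportional to the popularities. -/
noncomputable def Popularity.draw {α : Type*} (D : Popularity α) (S : Finset α)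
    (hS : S.Nonempty) : PMF S :=
  PMF.normalize (fun a : S => ENNReal.ofReal (D a.1))
    (by
      obtain ⟨a, ha⟩ := hS
      intro h
      have h0 := ENNReal.tsum_eq_zero.1 h ⟨a, ha⟩
      exact absurd (ENNReal.ofReal_eq_zero.1 h0) (not_le.2 (D.pos a)))
    (by
      rw [tsum_fintype]
      exact ENNReal.sum_ne_top.2 fun a _ => ENNReal.ofReal_ne_top)

/-- The random preference list of the elements of `S` given by popularities: draw the favourite,
then (from the remaining elements) the second favourite, and so on. -/
noncomputable def Popularity.listLaw {α : Type*} [DecidableEq α] (D : Popularity α)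
    (S : Finset α) : PMF (PrefList S) :=
  if hS : S.Nonempty then
    (D.draw S hS).bind fun a => (D.listLaw (S.erase a.1)).map (PrefList.cons a)
  else
    PMF.pure ⟨[], List.nodup_nil, fun a => by simp [Finset.not_nonempty_iff_eq_empty.1 hS]⟩
termination_by S.card
decreasing_by exact Finset.card_erase_lt_of_mem a.2

/-- A preference profile: every man ranks all women and every woman ranks all men. -/
abbrev Profile (M W : Type*) [Fintype M] [Fintype W] : Type _ :=
  (M → PrefList (Finset.univ : Finset W)) × (W → PrefList (Finset.univ : Finset M))

/-- The law of the profile in which all men and all women independently draw their preference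
lists from their popularities. -/
noncomputable def profileLaw {M W : Type*} [Fintype M] [Fintype W] [DecidableEq M] [DecidableEq W]
    (DM : M → Popularity W) (DW : W → Popularity M) : Measure (Profile M W) :=
  (Measure.pi fun m => ((DM m).listLaw Finset.univ).toMeasure).prod
    (Measure.pi fun w => ((DW w).listLaw Finset.univ).toMeasure)

/-- A matching between men and women; `none` means single. -/
structure Matching (M W : Type*) where
  wife : M → Option W
  husband : W → Option M
  consistent : ∀ m w, wife m = some w ↔ husband w = some m

/-- A person with preference list `l` strictly prefers `a` to the situation `x`
(`none` being single, the worst situation as everybody is acceptable). -/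
def PrefList.Prefers {α : Type*} [DecidableEq α] {S : Finset α} (l : PrefList S) (a : α)
    (x : Option α) : Prop :=
  ∀ b, x = some b → l.Before a b

/-- No man-woman pair is blocking. Nobody can block alone since all partners are acceptable. -/
def Matching.IsStable {M W : Type*} [Fintype M] [Fintype W] [DecidableEq M] [DecidableEq W]
    (μ : Matching M W) (P : Profile M W) : Prop :=
  ∀ m w, ¬ ((P.2 w).Prefers m (μ.husband w) ∧ (P.1 m).Prefers w (μ.wife m))

/-- `m` is a stable husband of `w`. -/
def IsStableHusband {M W : Type*} [Fintype M] [Fintype W] [DecidableEq M] [DecidableEq W]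
    (P : Profile M W) (w : W) (m : M) : Prop :=
  ∃ μ : Matching M W, μ.IsStable P ∧ μ.husband w = some m

/-- The maximal popularity ratio of two women in the eyes of a man. -/
noncomputable def maxRatio {M W : Type*} [Fintype M] [Fintype W] [Nonempty M] [Nonempty W]
    (DM : M → Popularity W) : ℝ :=
  (Finset.univ : Finset (M × W × W)).sup' Finset.univ_nonempty
    fun t => DM t.1 t.2.1 / DM t.1 t.2.2

/-- The maximal disagreement of two women on the popularity ratio of two men. -/
noncomputable def maxCrossRatio {M W : Type*} [Fintype M] [Fintype W] [Nonempty M] [Nonempty W]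
    (DW : W → Popularity M) : ℝ :=
  (Finset.univ : Finset ((W × W) × (M × M))).sup' Finset.univ_nonempty
    fun t => DW t.1.1 t.2.1 / DW t.1.1 t.2.2 * (DW t.1.2 t.2.2 / DW t.1.2 t.2.1)

/-! Popularities are measured on the scale of `w`, with `β = N ^ 5 * Q`. Since the popularity ratios
of two women differ by a factor at most `Q`, it is unlikely that a given woman ranks a man who
matters below one who is `β ^ 2` times less popular (`listLaw_hasInversion_le`). If `m₀` is more
than `β ^ (4r+3)` times as popular as `m₁`, cutting at powers of `β ^ 2` gives sets `C 1 ⊆ … ⊆ C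
(2r+2)` with `m₀` in the first and `m₁` outside the last, such that all women prefer the men of `C
i` to those outside `C (i+1)`.

Fix the women's lists. Let `w` reject everybody, let the men of `A = C (2r+1)` propose until they
stop, then let all men propose. If `m₀` and `m₁` are both stable husbands, then `m₀` proposes to
`w`, but not in the first phase. So in the second phase a woman leaves a man of `C i` for a man
outside, for every `i` from `1` to `2r+1` (`exists_takesOver`). Now reveal the men's lists one
proposal at a time. A takeover from `C i` has at most `|C i \ C (i-1)|` possible targets, while at
least `|W| - |C (i+2)|` women outside the reach of `C (i+2)` could be addressed instead, each at
least `1/R` times as likely as a target (`mul_crossEvent_le`). Such a landing enlarges the set of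
women held by `C (i+2)`, whose size is maximal when the phase starts, so it must be paid for by a
takeover from `C (i+2)`. Hence expected takeover numbers shrink by `R |C i \ C (i-1)| / (|W| - |C
(i+2)|)` per two layers. The product of these factors telescopes to at most `N ^ (6R) / 6 ^ r`
(`prod_le_rpow`), which is small for the chosen `r`. For `N < 60` there are more layers than
possible sizes, and two of them coincide.

One side of the market may be much larger than `N`. Only matched women matter: they are the same in
all stable matchings, and whether a woman can be single is independent of her own list
(`listsLaw_matched_inter_le`). The lists of the single women can be replaced by harmless ones. A
negligible second stable husband of `w` would have to be ranked high by two women, which is unlikely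
(`listsLaw_two_high_ranks_le`). -/

set_option linter.unusedSectionVars false

/-! ### Stable matchings: the same people are single in all of them -/

section StableMatchings

variable {M W : Type*} [Fintype M] [Fintype W] [DecidableEq M] [DecidableEq W]

theorem PrefList.mem_univ {α : Type*} [Fintype α] (l : PrefList (Finset.univ : Finset α)) (a : α) :
    a ∈ l.1 := (l.2.2 a).2 (Finset.mem_univ a)

theorem PrefList.length_univ {α : Type*} [Fintype α] [DecidableEq α]
    (l : PrefList (Finset.univ : Finset α)) : l.1.length = Fintype.card α := by
  rw [← List.toFinset_card_of_nodup l.2.1, ← Finset.card_univ]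
  congr 1
  ext a
  simp [l.mem_univ]

theorem PrefList.idxOf_inj {α : Type*} [Fintype α] [DecidableEq α]
    (l : PrefList (Finset.univ : Finset α)) {a b : α} (h : l.1.idxOf a = l.1.idxOf b) : a = b :=
  (List.idxOf_inj (l.mem_univ a)).1 h

theorem PrefList.before_of_not_before {α : Type*} [Fintype α] [DecidableEq α]
    (l : PrefList (Finset.univ : Finset α)) {a b : α} (h : ¬ l.Before a b) (hab : a ≠ b) :
    l.Before b a :=
  lt_of_le_of_ne (not_lt.1 h) fun h' => hab (l.idxOf_inj h').symm

/-- If the `η`-husbands of the women assigned by `κ` to a set of men lie again in this set, then all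
men of the set have an `η`-wife among these women. -/
theorem Matching.exists_wife_eq_of_chain {S : Finset M} {κ : M → W} (η : Matching M W)
    (hinj : Set.InjOn κ S) (h : ∀ m ∈ S, ∃ m' ∈ S, η.husband (κ m) = some m') {m : M}
    (hm : m ∈ S) : ∃ m' ∈ S, η.wife m = some (κ m') := by
  choose! f hfS hf using h
  have hfinj : Set.InjOn f S := by
    intro a ha b hb hab
    apply hinj ha hb
    have h1 := (η.consistent _ _).2 (hf a ha)
    have h2 := (η.consistent _ _).2 (hf b hb)
    rw [hab, h2] at h1
    exact (Option.some.inj h1).symm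
  obtain ⟨a, ha, rfl⟩ := Finset.surjOn_of_injOn_of_card_le f hfS hfinj le_rfl hm
  exact ⟨a, ha, (η.consistent _ _).2 (hf a ha)⟩

/-- Consider the men who prefer their `η`-wife to their situation in `η'`. Such a wife does not
block `η'`, so she has an `η'`-husband whom she prefers; he does not block `η` with her, so he is
again one of these men. By finiteness `η'` matches these men to the same women as `η`. -/
theorem Matching.IsStable.exists_wife_eq {P : Profile M W} {η η' : Matching M W}
    (hη : η.IsStable P) (hη' : η'.IsStable P) {m : M} {x : W} (hx : η.wife m = some x)
    (hpref : (P.1 m).Prefers x (η'.wife m)) : ∃ m' y, η.wife m' = some y ∧ η'.wife m = some y := by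
  classical
  set S : Finset M := Finset.univ.filter fun m =>
    ∃ x, η.wife m = some x ∧ (P.1 m).Prefers x (η'.wife m) with hS
  have hmem : ∀ {m}, m ∈ S ↔ ∃ x, η.wife m = some x ∧ (P.1 m).Prefers x (η'.wife m) := by
    simp [hS]
  have hmS : m ∈ S := hmem.2 ⟨x, hx, hpref⟩
  have : Nonempty W := ⟨x⟩
  have hc : ∀ m ∈ S, ∃ x, η.wife m = some x ∧ (P.1 m).Prefers x (η'.wife m) :=
    fun m h => hmem.1 h
  choose! κ hκ hκp using hc
  obtain ⟨m', hm', h⟩ := η'.exists_wife_eq_of_chain (S := S) (κ := κ) (fun a ha b hb hab => by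
      have h1 := (η.consistent _ _).1 (hκ a ha)
      have h2 := (η.consistent _ _).1 (hκ b hb)
      rw [hab, h2] at h1
      exact (Option.some.inj h1).symm) (fun a ha => by
      have h1 := hη' a (κ a)
      have h2 : ¬ (P.2 (κ a)).Prefers a (η'.husband (κ a)) := fun h => h1 ⟨h, hκp a ha⟩
      simp only [PrefList.Prefers, not_forall] at h2
      obtain ⟨b, hb, hab⟩ := h2
      have hbw := (η'.consistent _ _).2 hb
      have hne : a ≠ b := by
        rintro rfl
        have := hκp a ha _ hbw
        simp [PrefList.Before] at this
      have hba := (P.2 (κ a)).before_of_not_before hab hne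
      refine ⟨b, ?_, hb⟩
      have h3 : ¬ (P.1 b).Prefers (κ a) (η.wife b) := fun h => hη b (κ a) ⟨by
        rw [(η.consistent _ _).1 (hκ a ha)]
        intro c hc
        rw [← Option.some.inj hc]
        exact hba, h⟩
      simp only [PrefList.Prefers, not_forall] at h3
      obtain ⟨y, hy, hyb⟩ := h3
      refine hmem.2 ⟨y, hy, ?_⟩
      rw [hbw]
      intro c hc
      rw [← Option.some.inj hc]
      refine (P.1 b).before_of_not_before hyb ?_
      rintro rfl
      have h4 := (η.consistent _ _).1 hy
      rw [(η.consistent _ _).1 (hκ a ha)] at h4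
      exact hne (Option.some.inj h4)) hmS
  exact ⟨m', κ m', hκ m' hm', h⟩

theorem Matching.IsStable.wife_eq_none {P : Profile M W} {η η' : Matching M W}
    (hη : η.IsStable P) (hη' : η'.IsStable P) {m : M} (h : η.wife m = none) :
    η'.wife m = none := by
  by_contra hne
  obtain ⟨x, hx⟩ := Option.ne_none_iff_exists'.1 hne
  obtain ⟨m', y, -, hy⟩ := hη'.exists_wife_eq hη hx (by rw [h]; intro b hb; simp at hb)
  simp [h] at hy

/-- An `η'`-husband of `x` would block `η` with her unless he prefers his `η`-wife to `x`. Then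
`exists_wife_eq` says that his `η'`-wife, which is `x`, is matched in `η`. -/
theorem Matching.IsStable.husband_eq_none {P : Profile M W} {η η' : Matching M W}
    (hη : η.IsStable P) (hη' : η'.IsStable P) {x : W} (h : η.husband x = none) :
    η'.husband x = none := by
  by_contra hne
  obtain ⟨m, hm⟩ := Option.ne_none_iff_exists'.1 hne
  have hw := (η'.consistent _ _).2 hm
  have h1 : ¬ (P.1 m).Prefers x (η.wife m) := fun h' => hη m x ⟨by
    rw [h]; intro b hb; simp at hb, h'⟩
  simp only [PrefList.Prefers, not_forall] at h1
  obtain ⟨y, hy, hyx⟩ := h1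
  obtain ⟨m', z, hz, hz'⟩ := hη.exists_wife_eq hη' hy (by
    rw [hw]
    intro b hb
    rw [← Option.some.inj hb]
    refine (P.1 m).before_of_not_before hyx ?_
    rintro rfl
    have := (η.consistent _ _).1 hy
    simp [h] at this)
  rw [hw] at hz'
  rw [← Option.some.inj hz', η.consistent, h] at hz
  simp at hz

/-- Men preferred by `x` to her husband are matched to other women. -/
theorem Matching.IsStable.card_lt {P : Profile M W} {η : Matching M W} (hη : η.IsStable P)
    {x : W} {m : M} (hm : η.husband x = some m) {S : Finset M}
    (hS : ∀ a ∈ S, (P.2 x).Before a m) : S.card < Fintype.card W := by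
  have hw : ∀ a ∈ S, ∃ y, η.wife a = some y := by
    intro a ha
    by_contra hne
    push Not at hne
    refine hη a x ⟨?_, fun b hb => absurd hb (hne b)⟩
    rw [hm]
    intro b hb
    rw [← Option.some.inj hb]
    exact hS a ha
  have : Nonempty W := ⟨x⟩
  choose! f hf using hw
  have hlt : (Finset.univ.erase x).card < Fintype.card W :=
    Finset.card_erase_lt_of_mem (Finset.mem_univ x)
  refine lt_of_le_of_lt (Finset.card_le_card_of_injOn f (fun a ha => ?_) ?_) hlt
  · simp only [Finset.coe_erase, Finset.coe_univ, Set.mem_sdiff, Set.mem_univ, true_and,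
      Set.mem_singleton_iff]
    intro h
    have h1 := (η.consistent _ _).1 (hf a ha)
    rw [h, hm] at h1
    have h2 := hS a ha
    rw [Option.some.inj h1] at h2
    simp [PrefList.Before] at h2
  · intro a ha b hb hab
    have h1 := (η.consistent _ _).1 (hf a ha)
    have h2 := (η.consistent _ _).1 (hf b hb)
    rw [hab, h2] at h1
    exact (Option.some.inj h1).symm

theorem Matching.IsStable.idxOf_lt {P : Profile M W} {η : Matching M W} (hη : η.IsStable P)
    {x : W} {m : M} (hm : η.husband x = some m) :
    (P.2 x).1.idxOf m < Fintype.card W := by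
  have h := hη.card_lt hm (S := ((P.2 x).1.take ((P.2 x).1.idxOf m)).toFinset) (fun a ha => by
    rw [List.mem_toFinset, List.mem_take_iff_getElem] at ha
    obtain ⟨j, hj, rfl⟩ := ha
    rw [PrefList.Before, (P.2 x).2.1.idxOf_getElem]
    omega)
  rwa [List.toFinset_card_of_nodup ((P.2 x).2.1.sublist (List.take_sublist _ _)),
    List.length_take, min_eq_left List.idxOf_le_length] at h

/-- A matching in which `x` is single does not lose stability when `x` changes her list. -/
theorem Matching.IsStable.congr_of_single {P P' : Profile M W} {η : Matching M W}
    (hη : η.IsStable P) (h1 : P'.1 = P.1) (h2 : ∀ x, η.husband x ≠ none → P'.2 x = P.2 x) :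
    η.IsStable P' := by
  intro m x ⟨ha, hb⟩
  rw [h1] at hb
  -- A single woman accepts any man whatever her list is, so her list plays no role in stability.
  by_cases hx : η.husband x = none
  · exact hη m x ⟨by rw [hx]; intro b hb; simp at hb, hb⟩
  · rw [h2 x hx] at ha
    exact hη m x ⟨ha, hb⟩

end StableMatchings

/-! ### Random preference lists -/

section ListLaw

open scoped ENNReal

variable {α : Type*} [DecidableEq α]

theorem Popularity.draw_apply (D : Popularity α) {S : Finset α} (hS : S.Nonempty) (a : S) :
    D.draw S hS a = ENNReal.ofReal (D a.1 / ∑ b ∈ S, D b) := by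
  have hpos : 0 < ∑ b ∈ S, D b := Finset.sum_pos (fun b _ => D.pos b) hS
  rw [Popularity.draw, PMF.normalize_apply, tsum_fintype,
    Finset.sum_coe_sort S (fun b => ENNReal.ofReal (D b)),
    ← ENNReal.ofReal_sum_of_nonneg (fun b _ => (D.pos b).le),
    ENNReal.ofReal_div_of_pos hpos, div_eq_mul_inv]

theorem Popularity.listLaw_apply (D : Popularity α) {S : Finset α} (hS : S.Nonempty)
    (E : Set (PrefList S)) :
    (D.listLaw S).toOuterMeasure E = ∑ a : S, ENNReal.ofReal (D a.1 / ∑ b ∈ S, D b) *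
      (D.listLaw (S.erase a.1)).toOuterMeasure (PrefList.cons a ⁻¹' E) := by
  rw [Popularity.listLaw, dif_pos hS, PMF.toOuterMeasure_bind_apply, tsum_fintype]
  refine Finset.sum_congr rfl fun a _ => ?_
  rw [PMF.toOuterMeasure_map_apply, D.draw_apply]

/-- The probability that a random list starts with `p`. -/
noncomputable def Popularity.prefixProb (D : Popularity α) (S : Finset α) (p : List α) : ℝ≥0∞ :=
  (D.listLaw S).toOuterMeasure {l | p <+: l.1}

theorem Popularity.prefixProb_cons (D : Popularity α) {S : Finset α} {a : α} (ha : a ∈ S)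
    (p : List α) : D.prefixProb S (a :: p) =
      ENNReal.ofReal (D a / ∑ b ∈ S, D b) * D.prefixProb (S.erase a) p := by
  rw [prefixProb, D.listLaw_apply ⟨a, ha⟩, Finset.sum_eq_single (⟨a, ha⟩ : S)]
  · congr 2
    ext l
    simp [PrefList.cons]
  · intro b _ hb
    have : (PrefList.cons b ⁻¹' {l : PrefList S | a :: p <+: l.1}) = ∅ := by
      ext l
      simp only [Set.mem_preimage, Set.mem_ofPred_eq, Set.mem_empty_iff_false, iff_false]
      intro h
      exact hb (Subtype.ext (List.cons_prefix_cons.1 h).1.symm)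
    rw [this]
    simp
  · simp

theorem Popularity.prefixProb_cons_of_notMem (D : Popularity α) {S : Finset α} {a : α}
    (ha : a ∉ S) (p : List α) : D.prefixProb S (a :: p) = 0 := by
  have : {l : PrefList S | a :: p <+: l.1} = ∅ := by
    ext l
    simp only [Set.mem_ofPred_eq, Set.mem_empty_iff_false, iff_false]
    intro h
    exact ha ((l.2.2 a).1 (h.subset (by simp)))
  rw [prefixProb, this]
  simp

/-- Given its first entries, the next entry of a random list is drawn proportionally to
popularity. -/
theorem Popularity.prefixProb_append (D : Popularity α) {S : Finset α} (p : List α) {x y : α}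
    (hx : x ∈ S) (hy : y ∈ S) (hxp : x ∉ p) (hyp : y ∉ p) :
    D.prefixProb S (p ++ [x]) * ENNReal.ofReal (D y) =
      D.prefixProb S (p ++ [y]) * ENNReal.ofReal (D x) := by
  induction p generalizing S with
  | nil =>
    have hnil : ∀ T : Finset α, D.prefixProb T [] = 1 := by
      intro T
      rw [prefixProb]
      have : {l : PrefList T | [] <+: l.1} = Set.univ := by ext; simp
      rw [this, PMF.toOuterMeasure_apply_eq_one_iff]
      simp
    rw [List.nil_append, List.nil_append, D.prefixProb_cons hx, D.prefixProb_cons hy, hnil, hnil,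
      mul_one, mul_one, ← ENNReal.ofReal_mul, ← ENNReal.ofReal_mul]
    · congr 1
      ring
    · exact div_nonneg (D.pos _).le (Finset.sum_nonneg fun b _ => (D.pos b).le)
    · exact div_nonneg (D.pos _).le (Finset.sum_nonneg fun b _ => (D.pos b).le)
  | cons a p ih =>
    simp only [List.mem_cons, not_or] at hxp hyp
    by_cases ha : a ∈ S
    · rw [List.cons_append, List.cons_append, D.prefixProb_cons ha, D.prefixProb_cons ha, mul_assoc,
        mul_assoc, ih (Finset.mem_erase.2 ⟨hxp.1, hx⟩) (Finset.mem_erase.2 ⟨hyp.1, hy⟩) hxp.2 hyp.2]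
    · rw [List.cons_append, List.cons_append, D.prefixProb_cons_of_notMem ha,
        D.prefixProb_cons_of_notMem ha, zero_mul, zero_mul]

theorem Popularity.prefixProb_append_of_mem (D : Popularity α) {S : Finset α} {p : List α} {x : α}
    (hxp : x ∈ p) : D.prefixProb S (p ++ [x]) = 0 := by
  have : {l : PrefList S | p ++ [x] <+: l.1} = ∅ := by
    ext l
    simp only [Set.mem_ofPred_eq, Set.mem_empty_iff_false, iff_false]
    intro h
    have := (h.sublist.nodup l.2.1)
    rw [List.nodup_append] at this
    exact this.2.2 x hxp x (by simp) rfl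
  rw [prefixProb, this]
  simp

theorem Popularity.sum_draw (D : Popularity α) {S : Finset α} (hS : S.Nonempty) :
    ∑ a : S, ENNReal.ofReal (D a.1 / ∑ b ∈ S, D b) = 1 := by
  simp_rw [← D.draw_apply hS]
  rw [← tsum_fintype (L := SummationFilter.unconditional _), PMF.tsum_coe]

theorem PrefList.idxOf_cons_self {S : Finset α} (a : S) (l : PrefList (S.erase a.1)) :
    (PrefList.cons a l).1.idxOf a.1 = 0 := by
  simp [PrefList.cons]

theorem PrefList.idxOf_cons_of_ne {S : Finset α} (a : S) (l : PrefList (S.erase a.1)) {b : α}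
    (h : b ≠ a.1) : (PrefList.cons a l).1.idxOf b = l.1.idxOf b + 1 := by
  simp [PrefList.cons, List.idxOf_cons_ne _ (Ne.symm h)]

/-- Induction on the first draw. Drawing `a` first has `D a / D b` times the probability of drawing
`b` first, and in the latter case the event fails; so the contribution of `a` is charged to `b`. Any
other first draw leaves the same question for a smaller set. -/
theorem Popularity.listLaw_before_le (D : Popularity α) {S : Finset α} {a b : α} (ha : a ∈ S)
    (hb : b ∈ S) (hab : a ≠ b) :
    (D.listLaw S).toOuterMeasure {l | l.Before a b} ≤ ENNReal.ofReal (D a / D b) := by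
  induction hn : S.card generalizing S with
  | zero => simp [Finset.card_eq_zero.1 hn] at ha
  | succ n ih =>
    have hS : S.Nonempty := ⟨a, ha⟩
    have hpos : 0 < ∑ b ∈ S, D b := Finset.sum_pos (fun b _ => D.pos b) hS
    set d : S → ℝ≥0∞ := fun c => ENNReal.ofReal (D c.1 / ∑ b ∈ S, D b) with hd
    set g : S → ℝ≥0∞ := fun c => (D.listLaw (S.erase c.1)).toOuterMeasure
      (PrefList.cons c ⁻¹' {l | l.Before a b}) with hg
    set t := ENNReal.ofReal (D a / D b) with ht
    have hrest : ∀ c : S, c.1 ≠ a → c.1 ≠ b → g c ≤ t := by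
      intro c hca hcb
      have : PrefList.cons c ⁻¹' {l | l.Before a b} =
          {l : PrefList (S.erase c.1) | l.Before a b} := by
        ext l
        simp [PrefList.Before, PrefList.idxOf_cons_of_ne c l hca.symm,
          PrefList.idxOf_cons_of_ne c l hcb.symm]
      rw [hg]
      simp only [this]
      exact ih (Finset.mem_erase.2 ⟨hca.symm, ha⟩) (Finset.mem_erase.2 ⟨hcb.symm, hb⟩)
        (by rw [Finset.card_erase_of_mem c.2, hn]; rfl)
    have hgb : g ⟨b, hb⟩ = 0 := by
      have : PrefList.cons ⟨b, hb⟩ ⁻¹' {l : PrefList S | l.Before a b} = ∅ := by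
        ext l
        simp [PrefList.Before, PrefList.idxOf_cons_self (⟨b, hb⟩ : S) l]
      simp only [hg, this]
      simp
    have hga : g ⟨a, ha⟩ ≤ 1 := by
      rw [hg]
      refine le_trans (measure_mono (Set.subset_univ _)) ?_
      exact le_of_eq ((PMF.toOuterMeasure_apply_eq_one_iff _ _).2 (Set.subset_univ _))
    have hda : d ⟨a, ha⟩ = d ⟨b, hb⟩ * t := by
      rw [hd, ht, ← ENNReal.ofReal_mul (div_nonneg (D.pos _).le hpos.le)]
      have := (D.pos b).ne'
      field_simp
    have hne : (⟨b, hb⟩ : S) ∈ Finset.univ.erase (⟨a, ha⟩ : S) := by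
      simp [Ne.symm hab]
    rw [D.listLaw_apply hS]
    calc ∑ c : S, d c * g c
        = d ⟨a, ha⟩ * g ⟨a, ha⟩ + (d ⟨b, hb⟩ * g ⟨b, hb⟩ +
          ∑ c ∈ (Finset.univ.erase ⟨a, ha⟩).erase ⟨b, hb⟩, d c * g c) := by
          rw [Finset.add_sum_erase _ (fun c => d c * g c) hne,
            Finset.add_sum_erase _ (fun c => d c * g c) (Finset.mem_univ _)]
      _ ≤ d ⟨b, hb⟩ * t + ∑ c ∈ (Finset.univ.erase ⟨a, ha⟩).erase ⟨b, hb⟩, d c * t := by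
          rw [hgb, mul_zero, zero_add, ← hda]
          refine add_le_add ((mul_le_mul_right hga _).trans (by rw [mul_one])) ?_
          refine Finset.sum_le_sum fun c hc => mul_le_mul_right ?_ _
          simp only [Finset.mem_erase, Finset.mem_univ, and_true] at hc
          exact hrest c (fun h => hc.2 (Subtype.ext h)) (fun h => hc.1 (Subtype.ext h))
      _ = ∑ c ∈ Finset.univ.erase ⟨a, ha⟩, d c * t :=
          Finset.add_sum_erase _ (fun c => d c * t) hne
      _ ≤ ∑ c : S, d c * t := Finset.sum_le_sum_of_subset (Finset.subset_univ _)
      _ = t := by rw [← Finset.sum_mul, D.sum_draw hS, one_mul]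

/-- If `a` has small relative popularity after the removal of any fewer than `k` elements, then
it is unlikely to be one of the first `k` elements of the list. -/
theorem Popularity.listLaw_idxOf_lt_le (D : Popularity α) {S : Finset α} {a : α} (ha : a ∈ S)
    {ε : ℝ} (k : ℕ)
    (h : ∀ T ⊆ S, T.card < k → D a ≤ ε * ∑ b ∈ S \ T, D b) :
    (D.listLaw S).toOuterMeasure {l | l.1.idxOf a < k} ≤ k * ENNReal.ofReal ε := by
  induction k generalizing S with
  | zero => simp
  | succ k ih =>
    have hS : S.Nonempty := ⟨a, ha⟩
    have hpos : 0 < ∑ b ∈ S, D b := Finset.sum_pos (fun b _ => D.pos b) hS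
    have hda : ENNReal.ofReal (D a / ∑ b ∈ S, D b) ≤ ENNReal.ofReal ε := by
      refine ENNReal.ofReal_le_ofReal ?_
      rw [div_le_iff₀ hpos]
      simpa using h ∅ (Finset.empty_subset _) (by simp)
    rw [D.listLaw_apply hS, ← Finset.add_sum_erase _ _ (Finset.mem_univ (⟨a, ha⟩ : S))]
    push_cast
    rw [add_mul, one_mul, add_comm ((k : ℝ≥0∞) * _)]
    refine add_le_add ?_ ?_
    · refine le_trans (mul_le_of_le_one_right' ?_) hda
      refine le_trans (measure_mono (Set.subset_univ _)) ?_
      exact le_of_eq ((PMF.toOuterMeasure_apply_eq_one_iff _ _).2 (Set.subset_univ _))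
    · calc _ ≤ ∑ c ∈ Finset.univ.erase (⟨a, ha⟩ : S), ENNReal.ofReal (D c.1 / ∑ b ∈ S, D b) *
            (k * ENNReal.ofReal ε) := by
            refine Finset.sum_le_sum fun c hc => mul_le_mul_right ?_ _
            have hca : a ≠ c.1 := fun h => by
              simp only [Finset.mem_erase, Finset.mem_univ, and_true] at hc
              exact hc (Subtype.ext h.symm)
            have : PrefList.cons c ⁻¹' {l : PrefList S | l.1.idxOf a < k + 1} =
                {l : PrefList (S.erase c.1) | l.1.idxOf a < k} := by
              ext l
              simp [PrefList.idxOf_cons_of_ne c l hca]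
            rw [this]
            refine ih (Finset.mem_erase.2 ⟨hca, ha⟩) fun T hT hTk => ?_
            have hcT : c.1 ∉ T := fun h => by simpa using hT h
            -- The first draw `c` counts as one of the allowed removals.
            have := h (insert c.1 T) (Finset.insert_subset c.2
              (hT.trans (Finset.erase_subset _ _))) (by
                rw [Finset.card_insert_of_notMem hcT]; omega)
            rwa [Finset.sdiff_insert, ← Finset.erase_sdiff_comm] at this
        _ ≤ ∑ c : S, ENNReal.ofReal (D c.1 / ∑ b ∈ S, D b) * (k * ENNReal.ofReal ε) :=
          Finset.sum_le_sum_of_subset (Finset.subset_univ _)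
        _ = _ := by rw [← Finset.sum_mul, D.sum_draw hS, one_mul]

end ListLaw

/-! ### Initial segments of lists -/

section PrefixLemmas

variable {α : Type*}

theorem List.append_singleton_prefix_iff {p l : List α} (h : p <+: l) (x : α) :
    p ++ [x] <+: l ↔ l[p.length]? = some x := by
  obtain ⟨t, rfl⟩ := h
  rw [List.prefix_append_right_inj]
  cases t <;> simp [eq_comm]

theorem List.IsPrefix.mem_of_idxOf_lt [DecidableEq α] {p l : List α} (h : p <+: l) {x y : α}
    (hy : y ∈ p) (hxy : l.idxOf x < l.idxOf y) : x ∈ p := by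
  obtain ⟨t, rfl⟩ := h
  by_contra hx
  rw [List.idxOf_append_of_mem hy, List.idxOf_append_of_notMem hx] at hxy
  have := List.idxOf_lt_length_iff.2 hy
  omega

theorem List.IsPrefix.mem_of_idxOf_lt_length [DecidableEq α] {p l : List α} (h : p <+: l) {x : α}
    (hx : l.idxOf x < p.length) : x ∈ p := by
  obtain ⟨t, rfl⟩ := h
  by_contra hx'
  rw [List.idxOf_append_of_notMem hx'] at hx
  omega

end PrefixLemmas

/-! ### Deferred acceptance with excluded women and restricted movers -/

section DeferredAcceptance

variable {M W : Type*} [Fintype M] [Fintype W] [DecidableEq M] [DecidableEq W]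

/-- A state of the men-proposing deferred acceptance procedure: the proposals that every man has
made, in chronological order, and the man held by every woman. -/
structure DAState (M W : Type*) where
  pre : M → List W
  hold : W → Option M

namespace DAState

/-- `m` is not held by any woman and has not yet proposed to all women. -/
def CanMove (s : DAState M W) (m : M) : Prop :=
  (∀ x, s.hold x ≠ some m) ∧ (s.pre m).length < Fintype.card W

open Classical in
/-- A man satisfying `B` who makes the next proposal. -/
noncomputable def mover (s : DAState M W) (B : M → Prop) : Option M :=
  if h : ∃ m, B m ∧ s.CanMove m then some h.choose else none

/-- `x` would accept a proposal of `m`; the women satisfying `ex` reject everybody. -/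
def Accepts (LW : W → PrefList (Finset.univ : Finset M)) (ex : W → Prop) (s : DAState M W) (m : M)
    (x : W) : Prop :=
  ¬ ex x ∧ (LW x).Prefers m (s.hold x)

open Classical in
/-- The state after a proposal of `m` to `x`. -/
noncomputable def propose (LW : W → PrefList (Finset.univ : Finset M)) (ex : W → Prop)
    (s : DAState M W) (m : M) (x : W) : DAState M W where
  pre := Function.update s.pre m (s.pre m ++ [x])
  hold := if s.Accepts LW ex m x then Function.update s.hold x (some m) else s.hold

/-- The next proposal, if any, when only men satisfying `B` may move. -/
noncomputable def next (L : M → PrefList (Finset.univ : Finset W)) (B : M → Prop)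
    (s : DAState M W) : Option (M × W) :=
  (s.mover B).bind fun m => ((L m).1[(s.pre m).length]?).map fun x => (m, x)

/-- One step of the procedure when only men satisfying `B` may move. -/
noncomputable def step (LW : W → PrefList (Finset.univ : Finset M)) (ex : W → Prop)
    (L : M → PrefList (Finset.univ : Finset W)) (B : M → Prop) (s : DAState M W) : DAState M W :=
  match s.next L B with
  | none => s
  | some p => s.propose LW ex p.1 p.2

/-- The invariants of the procedure. -/
structure Inv (LW : W → PrefList (Finset.univ : Finset M)) (ex : W → Prop)
    (L : M → PrefList (Finset.univ : Finset W)) (s : DAState M W) : Prop where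
  pre_prefix : ∀ m, s.pre m <+: (L m).1
  hold_mem : ∀ {x m}, s.hold x = some m → ¬ ex x ∧ x ∈ s.pre m
  hold_inj : ∀ {x y m}, s.hold x = some m → s.hold y = some m → x = y
  best : ∀ {x m}, x ∈ s.pre m → ¬ ex x → ∃ m', s.hold x = some m' ∧ ¬ (LW x).Before m m'

theorem mover_eq_some {s : DAState M W} {B : M → Prop} {m : M} (h : s.mover B = some m) :
    B m ∧ s.CanMove m := by
  rw [mover] at h
  split_ifs at h with h'
  rw [← Option.some.inj h]
  exact h'.choose_spec

theorem mover_eq_none {s : DAState M W} {B : M → Prop} (h : s.mover B = none) {m : M} (hm : B m) :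
    ¬ s.CanMove m := by
  rw [mover] at h
  split_ifs at h with h'
  exact fun h => h' ⟨m, hm, h⟩

theorem next_eq_some {L : M → PrefList (Finset.univ : Finset W)} {s : DAState M W} {B : M → Prop}
    {m : M} {x : W} : s.next L B = some (m, x) ↔
      s.mover B = some m ∧ (L m).1[(s.pre m).length]? = some x := by
  simp only [next, Option.bind_eq_some_iff, Option.map_eq_some_iff, Prod.mk.injEq]
  constructor
  · rintro ⟨a, ha, b, hb, rfl, rfl⟩
    exact ⟨ha, hb⟩
  · rintro ⟨ha, hb⟩
    exact ⟨m, ha, x, hb, rfl, rfl⟩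

theorem next_eq_none {L : M → PrefList (Finset.univ : Finset W)} {s : DAState M W} {B : M → Prop}
    (h : s.next L B = none) {m : M} (hm : B m) : ¬ s.CanMove m := by
  cases hmo : s.mover B with
  | none => exact mover_eq_none hmo hm
  | some a =>
    exfalso
    have := (mover_eq_some hmo).2.2
    rw [← (L a).length_univ] at this
    simp [next, hmo, List.getElem?_eq_getElem this] at h

theorem step_of_none {LW : W → PrefList (Finset.univ : Finset M)} {ex : W → Prop}
    {L : M → PrefList (Finset.univ : Finset W)} {s : DAState M W} {B : M → Prop}
    (h : s.next L B = none) : s.step LW ex L B = s := by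
  simp [step, h]

theorem step_of_some {LW : W → PrefList (Finset.univ : Finset M)} {ex : W → Prop}
    {L : M → PrefList (Finset.univ : Finset W)} {s : DAState M W} {B : M → Prop} {m : M} {x : W}
    (h : s.next L B = some (m, x)) : s.step LW ex L B = s.propose LW ex m x := by
  simp [step, h]

section

variable {LW : W → PrefList (Finset.univ : Finset M)} {ex : W → Prop}
  {L : M → PrefList (Finset.univ : Finset W)} {s : DAState M W}

theorem mem_pre_propose {m a : M} {x y : W} :
    y ∈ (s.propose LW ex m x).pre a ↔ y ∈ s.pre a ∨ (a = m ∧ y = x) := by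
  by_cases h : a = m
  · subst h; simp [propose]
  · simp [propose, h]

theorem hold_propose_of_accepts {m : M} {x : W} (h : s.Accepts LW ex m x) (y : W) :
    (s.propose LW ex m x).hold y = if y = x then some m else s.hold y := by
  simp [propose, h, Function.update_apply]

theorem hold_propose_of_not_accepts {m : M} {x : W} (h : ¬ s.Accepts LW ex m x) :
    (s.propose LW ex m x).hold = s.hold := by
  simp [propose, h]

theorem Inv.propose (hs : s.Inv LW ex L) {m : M} {x : W} (hm : s.CanMove m)
    (hx : (L m).1[(s.pre m).length]? = some x) : (s.propose LW ex m x).Inv LW ex L := by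
  by_cases hacc : s.Accepts LW ex m x
  · have hold := hold_propose_of_accepts hacc
    refine ⟨fun a => ?_, fun {y a} h => ?_, fun {y z a} hy hz => ?_, fun {y a} h hex => ?_⟩
    · by_cases h : a = m
      · subst h
        simpa [DAState.propose] using
          (List.append_singleton_prefix_iff (hs.pre_prefix a) x).2 hx
      · simpa [DAState.propose, h] using hs.pre_prefix a
    · rw [hold] at h
      rw [mem_pre_propose]
      split_ifs at h with hyx
      · subst hyx
        exact ⟨hacc.1, Or.inr ⟨(Option.some.inj h).symm, rfl⟩⟩
      · exact ⟨(hs.hold_mem h).1, Or.inl (hs.hold_mem h).2⟩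
    · rw [hold] at hy hz
      split_ifs at hy hz with h1 h2 h2
      · rw [h1, h2]
      · rw [← Option.some.inj hy] at hz
        exact absurd hz (hm.1 z)
      · rw [← Option.some.inj hz] at hy
        exact absurd hy (hm.1 y)
      · exact hs.hold_inj hy hz
    · rw [mem_pre_propose] at h
      rw [hold]
      split_ifs with hyx
      · subst hyx
        refine ⟨m, rfl, ?_⟩
        rcases h with h | ⟨rfl, -⟩
        · obtain ⟨m', hm', hb⟩ := hs.best h hex
          have := hacc.2 m' hm'
          simp only [PrefList.Before] at this hb ⊢
          omega
        · simp [PrefList.Before]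
      · exact hs.best (h.resolve_right fun h => hyx h.2) hex
  · have hold := hold_propose_of_not_accepts hacc
    refine ⟨fun a => ?_, fun {y a} h => ?_, fun {y z a} hy hz => ?_, fun {y a} h hex => ?_⟩
    · by_cases h : a = m
      · subst h
        simpa [DAState.propose] using
          (List.append_singleton_prefix_iff (hs.pre_prefix a) x).2 hx
      · simpa [DAState.propose, h] using hs.pre_prefix a
    · rw [hold] at h
      rw [mem_pre_propose]
      exact ⟨(hs.hold_mem h).1, Or.inl (hs.hold_mem h).2⟩
    · rw [hold] at hy hz
      exact hs.hold_inj hy hz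
    · rw [mem_pre_propose] at h
      rw [hold]
      rcases h with h | ⟨rfl, rfl⟩
      · exact hs.best h hex
      · have : ¬ (LW y).Prefers a (s.hold y) := fun h => hacc ⟨hex, h⟩
        simpa [PrefList.Prefers] using this

theorem Inv.step (hs : s.Inv LW ex L) (B : M → Prop) : (s.step LW ex L B).Inv LW ex L := by
  cases h : s.next L B with
  | none => rwa [step_of_none h]
  | some p =>
    rw [step_of_some h]
    obtain ⟨h1, h2⟩ := next_eq_some.1 h
    exact hs.propose (mover_eq_some h1).2 h2

theorem Inv.length_le (hs : s.Inv LW ex L) (m : M) : (s.pre m).length ≤ Fintype.card W := by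
  rw [← (L m).length_univ]
  exact (hs.pre_prefix m).length_le

theorem Inv.mem_pre_of_length (hs : s.Inv LW ex L) {m : M}
    (h : Fintype.card W ≤ (s.pre m).length) (x : W) : x ∈ s.pre m := by
  rw [(hs.pre_prefix m).eq_of_length_le (by rwa [(L m).length_univ])]
  exact (L m).mem_univ x

/-- A man who can no longer move and is not held has proposed to everybody. -/
theorem Inv.mem_pre_of_not_canMove (hs : s.Inv LW ex L) {m : M} (h : ¬ s.CanMove m)
    (h' : ∀ x, s.hold x ≠ some m) (x : W) : x ∈ s.pre m :=
  hs.mem_pre_of_length (not_lt.1 fun hlt => h ⟨h', hlt⟩) x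

end

end DAState

/-- The run of the deferred acceptance procedure in which the men satisfying `act k` may move at
time `k`. -/
noncomputable def daRun (LW : W → PrefList (Finset.univ : Finset M)) (ex : W → Prop)
    (act : ℕ → M → Prop) (L : M → PrefList (Finset.univ : Finset W)) : ℕ → DAState M W
  | 0 => ⟨fun _ => [], fun _ => none⟩
  | k + 1 => (daRun LW ex act L k).step LW ex L (act k)

section

variable {LW : W → PrefList (Finset.univ : Finset M)} {ex : W → Prop} {act : ℕ → M → Prop}
  {L : M → PrefList (Finset.univ : Finset W)}

theorem daRun_inv (k : ℕ) : (daRun LW ex act L k).Inv LW ex L := by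
  induction k with
  | zero => exact ⟨by simp [daRun], by simp [daRun], by simp [daRun], by simp [daRun]⟩
  | succ k ih => exact ih.step _

/-- A step without a proposal fixes the state, so a run with constant `B` never resumes once it
pauses. If it still moves at time `a + n`, each of the `n` steps made a proposal. -/
theorem le_sum_length_daRun {B : M → Prop} {a : ℕ} (n : ℕ) (hB : ∀ k < n + 1, act (a + k) = B)
    (h : (daRun LW ex act L (a + n)).next L B ≠ none) :
    n ≤ ∑ m, ((daRun LW ex act L (a + n)).pre m).length := by
  induction n with
  | zero => simp
  | succ n ih =>
    cases hn : (daRun LW ex act L (a + n)).next L B with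
    | none =>
      have : daRun LW ex act L (a + (n + 1)) = daRun LW ex act L (a + n) := by
        rw [← add_assoc, daRun, hB n (by omega), DAState.step_of_none hn]
      rw [this] at h
      exact absurd hn h
    | some p =>
      have h1 := ih (fun k hk => hB k (by omega)) (by simp [hn])
      rw [← add_assoc, daRun, hB n (by omega), DAState.step_of_some hn]
      refine Nat.succ_le_of_lt (lt_of_le_of_lt h1 (Finset.sum_lt_sum (fun m _ => ?_)
        ⟨p.1, Finset.mem_univ _, by simp [DAState.propose]⟩))
      by_cases hm : m = p.1
      · subst hm; simp [DAState.propose]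
      · simp [DAState.propose, hm]

/-- After sufficiently many steps nobody can move. -/
theorem not_canMove_daRun {B : M → Prop} {a : ℕ}
    (hB : ∀ k < Fintype.card M * Fintype.card W, act (a + k) = B) {m : M} (hm : B m) :
    ¬ (daRun LW ex act L (a + Fintype.card M * Fintype.card W)).CanMove m := by
  classical
  -- the choice of active men at the final time does not influence the run up to this time
  set T := Fintype.card M * Fintype.card W with hT
  set act' : ℕ → M → Prop := fun k => if k < a + T then act k else B with hact'
  have hrun : ∀ k ≤ a + T, daRun LW ex act' L k = daRun LW ex act L k := by
    intro k
    induction k with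
    | zero => intro _; rfl
    | succ k ih =>
      intro hk
      rw [daRun, daRun, ih (by omega), hact']
      simp only
      rw [if_pos (by omega)]
  rw [← hrun _ le_rfl]
  have hB' : ∀ k < T + 1, act' (a + k) = B := by
    intro k hk
    simp only [hact']
    split_ifs with h
    · exact hB k (by omega)
    · rfl
  cases hn : (daRun LW ex act' L (a + T)).next L B with
  | none => exact DAState.next_eq_none hn hm
  | some p =>
    intro hmove
    have h1 := le_sum_length_daRun T hB' (by rw [hn]; simp)
    have hle := fun m => (daRun_inv (LW := LW) (ex := ex) (act := act') (L := L)
      (a + T)).length_le m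
    -- A man who can still move has an unused proposal, so fewer than `T` proposals were made.
    have h2 : ∑ m, ((daRun LW ex act' L (a + T)).pre m).length < ∑ _m : M, Fintype.card W :=
      Finset.sum_lt_sum (fun m _ => hle m) ⟨m, Finset.mem_univ _, hmove.2⟩
    rw [Finset.sum_const, Finset.card_univ, smul_eq_mul] at h2
    omega

end

/-- The Gale–Shapley argument with no excluded woman: a man has proposed to every woman whom he
prefers to his final situation, and each of them holds someone at least as good. -/
theorem exists_isStable (P : Profile M W) : ∃ η : Matching M W, η.IsStable P := by
  classical
  set T := Fintype.card M * Fintype.card W with hT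
  set s := daRun P.2 (fun _ => False) (fun _ _ => True) P.1 (0 + T) with hs
  have hinv : s.Inv P.2 (fun _ => False) P.1 := daRun_inv _
  have hend : ∀ m, ¬ s.CanMove m := fun m =>
    not_canMove_daRun (B := fun _ => True) (fun _ _ => rfl) trivial
  refine ⟨⟨fun m => if h : ∃ x, s.hold x = some m then some h.choose else none, s.hold,
    fun m x => ?_⟩, fun m x h => ?_⟩
  · constructor
    · intro h
      split_ifs at h with h'
      rw [← Option.some.inj h]
      exact h'.choose_spec
    · intro h
      have h' : ∃ x, s.hold x = some m := ⟨x, h⟩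
      rw [dif_pos h', hinv.hold_inj h'.choose_spec h]
  · obtain ⟨h1, h2⟩ := h
    have hx : x ∈ s.pre m := by
      by_cases h : ∃ y, s.hold y = some m
      · have := h2 h.choose (by simp [h])
        exact (hinv.pre_prefix m).mem_of_idxOf_lt (hinv.hold_mem h.choose_spec).2 this
      · push Not at h
        exact hinv.mem_pre_of_not_canMove (hend m) h x
    obtain ⟨m', hm', hb⟩ := hinv.best hx (by simp)
    exact hb (h1 m' hm')

end DeferredAcceptance

/-! ### Rejection by `w`, and the two-phase procedure -/

section TwoPhases

variable {M W : Type*} [Fintype M] [Fintype W] [DecidableEq M] [DecidableEq W]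

/-- The number of steps after which the deferred acceptance procedure has certainly stopped. -/
def daTime (M W : Type*) [Fintype M] [Fintype W] : ℕ := Fintype.card M * Fintype.card W

/-- The procedure in which `w` rejects everybody and first only the men of `A` move. -/
noncomputable def twoPhaseRun (LW : W → PrefList (Finset.univ : Finset M)) (w : W) (A : Finset M)
    (L : M → PrefList (Finset.univ : Finset W)) (k : ℕ) : DAState M W :=
  -- From time `daTime M W` on the implication is vacuous and all men may move.
  daRun LW (fun x => x = w) (fun k m => k < daTime M W → m ∈ A) L k

/-- The next proposal in `twoPhaseRun`. -/
noncomputable def twoPhaseNext (LW : W → PrefList (Finset.univ : Finset M)) (w : W) (A : Finset M)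
    (L : M → PrefList (Finset.univ : Finset W)) (k : ℕ) : Option (M × W) :=
  (twoPhaseRun LW w A L k).next L (fun m => k < daTime M W → m ∈ A)

/-- A proposal of `m` to `x` makes `x` leave a man of `B` for the man `m` outside of `B`. -/
def DAState.TakesOver (LW : W → PrefList (Finset.univ : Finset M)) (w : W) (B : Finset M)
    (s : DAState M W) (p : M × W) : Prop :=
  p.1 ∉ B ∧ s.Accepts LW (fun x => x = w) p.1 p.2 ∧ ∃ m ∈ B, s.hold p.2 = some m

variable {LW : W → PrefList (Finset.univ : Finset M)} {w : W} {A : Finset M}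
  {L : M → PrefList (Finset.univ : Finset W)}

theorem twoPhaseRun_inv (k : ℕ) : (twoPhaseRun LW w A L k).Inv LW (fun x => x = w) L :=
  daRun_inv k

theorem twoPhaseRun_succ_of_none {k : ℕ} (h : twoPhaseNext LW w A L k = none) :
    twoPhaseRun LW w A L (k + 1) = twoPhaseRun LW w A L k :=
  DAState.step_of_none h

theorem twoPhaseRun_succ_of_some {k : ℕ} {p : M × W} (h : twoPhaseNext LW w A L k = some p) :
    twoPhaseRun LW w A L (k + 1) =
      (twoPhaseRun LW w A L k).propose LW (fun x => x = w) p.1 p.2 :=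
  DAState.step_of_some h

theorem twoPhaseNext_eq_some {k : ℕ} {m : M} {x : W} (h : twoPhaseNext LW w A L k = some (m, x)) :
    (k < daTime M W → m ∈ A) ∧ (twoPhaseRun LW w A L k).CanMove m ∧
      (L m).1[((twoPhaseRun LW w A L k).pre m).length]? = some x := by
  obtain ⟨h1, h2⟩ := DAState.next_eq_some.1 h
  exact ⟨(DAState.mover_eq_some h1).1, (DAState.mover_eq_some h1).2, h2⟩

theorem mem_of_mem_pre_twoPhaseRun {k : ℕ} (hk : k ≤ daTime M W) {m : M} {x : W}
    (hx : x ∈ (twoPhaseRun LW w A L k).pre m) : m ∈ A := by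
  induction k with
  | zero => simp [twoPhaseRun, daRun] at hx
  | succ k ih =>
    cases h : twoPhaseNext LW w A L k with
    | none =>
      rw [twoPhaseRun_succ_of_none h] at hx
      exact ih (by omega) hx
    | some p =>
      rw [twoPhaseRun_succ_of_some h, DAState.mem_pre_propose] at hx
      rcases hx with hx | ⟨rfl, -⟩
      · exact ih (by omega) hx
      · exact (twoPhaseNext_eq_some h).1 (by omega)

/-- At the end of the first phase all men of `A` are held. -/
theorem exists_hold_of_mem (hA : A.card < Fintype.card W) {m : M} (hm : m ∈ A) :
    ∃ x, (twoPhaseRun LW w A L (daTime M W)).hold x = some m := by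
  by_contra hne
  push Not at hne
  set s := twoPhaseRun LW w A L (daTime M W) with hs
  have hinv : s.Inv LW (fun x => x = w) L := twoPhaseRun_inv _
  have hmove : ¬ s.CanMove m := by
    have := not_canMove_daRun (LW := LW) (ex := fun x => x = w) (L := L)
      (act := fun k m => k < daTime M W → m ∈ A) (B := fun m => m ∈ A) (a := 0)
      (fun k hk => by
        funext a
        have : k < daTime M W := hk
        simp [this]) hm
    rw [zero_add] at this
    exact this
  have hall := hinv.mem_pre_of_not_canMove hmove hne
  have hhold : ∀ x ∈ Finset.univ.erase w, ∃ a, s.hold x = some a := by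
    intro x hx
    obtain ⟨a, ha, -⟩ := hinv.best (hall x) (Finset.ne_of_mem_erase hx)
    exact ⟨a, ha⟩
  have : Nonempty M := ⟨m⟩
  choose! f hf using hhold
  -- A man of `A` refused by everyone forces all women except `w` to hold other men of `A`, which
  -- are too few.
  have hcard : (Finset.univ.erase w).card ≤ (A.erase m).card := by
    refine Finset.card_le_card_of_injOn f (fun x hx => ?_) (fun x hx y hy hxy => ?_)
    · rw [Finset.mem_coe, Finset.mem_erase]
      refine ⟨fun h => hne x (by rw [hf x hx, h]), ?_⟩
      exact mem_of_mem_pre_twoPhaseRun le_rfl (hinv.hold_mem (hf x hx)).2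
    · have h1 := hf x hx
      rw [hxy] at h1
      exact hinv.hold_inj h1 (hf y hy)
  rw [Finset.card_erase_of_mem (Finset.mem_univ w), Finset.card_erase_of_mem hm,
    Finset.card_univ] at hcard
  have := Finset.card_pos.2 ⟨m, hm⟩
  omega

/-- If no man outside of `B` takes over a woman from a man of `B`, then the men of `B` make no
proposals in the second phase. -/
theorem pre_twoPhaseRun_eq {B : Finset M} (hA : A.card < Fintype.card W) (hB : B ⊆ A) {n : ℕ}
    (h : ∀ k, daTime M W ≤ k → k < n → ∀ p, twoPhaseNext LW w A L k = some p →
      ¬ (twoPhaseRun LW w A L k).TakesOver LW w B p) (hn : daTime M W ≤ n) :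
    ∀ m ∈ B, (twoPhaseRun LW w A L n).pre m = (twoPhaseRun LW w A L (daTime M W)).pre m ∧
      ∃ x, (twoPhaseRun LW w A L n).hold x = some m := by
  induction n, hn using Nat.le_induction with
  | base => exact fun m hm => ⟨rfl, exists_hold_of_mem hA (hB hm)⟩
  | succ n hn ih =>
    have ih' := ih (fun k hk hkn => h k hk (by omega))
    intro m hm
    cases hnext : twoPhaseNext LW w A L n with
    | none =>
      rw [twoPhaseRun_succ_of_none hnext]
      exact ih' m hm
    | some p =>
      have hp := twoPhaseNext_eq_some hnext
      have hpB : p.1 ∉ B := fun hpB => by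
        obtain ⟨x, hx⟩ := (ih' _ hpB).2
        exact hp.2.1.1 x hx
      have hmp : m ≠ p.1 := fun h => hpB (h ▸ hm)
      obtain ⟨h1, x, hx⟩ := ih' m hm
      rw [twoPhaseRun_succ_of_some hnext]
      refine ⟨by simpa [DAState.propose, hmp] using h1, x, ?_⟩
      by_cases hacc : (twoPhaseRun LW w A L n).Accepts LW (fun x => x = w) p.1 p.2
      · rw [DAState.hold_propose_of_accepts hacc]
        rw [if_neg, hx]
        rintro rfl
        exact h n hn (by omega) p hnext ⟨hpB, hacc, m, hm, hx⟩
      · rw [DAState.hold_propose_of_not_accepts hacc, hx]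

/-- If `w` has a husband worse than all men of `A` in a stable matching, then no man of `A`
proposes to someone worse than his wife in this matching during the first phase. -/
theorem idxOf_le_of_mem_pre {P : Profile M W} {η : Matching M W} (hη : η.IsStable P) {m₁ : M}
    (hm₁ : η.husband w = some m₁) (hA : ∀ m ∈ A, (P.2 w).Before m m₁) {k : ℕ}
    (hk : k ≤ daTime M W) {m : M} {y : W}
    (hy : y ∈ (twoPhaseRun P.2 w A P.1 k).pre m) :
    ∃ z, η.wife m = some z ∧ (P.1 m).1.idxOf y ≤ (P.1 m).1.idxOf z ∧ (P.1 m).Before z w := by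
  have hwife : ∀ m ∈ A, ∃ z, η.wife m = some z ∧ (P.1 m).Before z w := by
    intro m hm
    have h1 : ¬ (P.1 m).Prefers w (η.wife m) := fun h => hη m w ⟨by
      rw [hm₁]
      intro b hb
      rw [← Option.some.inj hb]
      exact hA m hm, h⟩
    simp only [PrefList.Prefers, not_forall] at h1
    obtain ⟨z, hz, hzw⟩ := h1
    refine ⟨z, hz, (P.1 m).before_of_not_before hzw ?_⟩
    rintro rfl
    rw [η.consistent, hm₁] at hz
    have := hA m hm
    rw [Option.some.inj hz] at this
    simp [PrefList.Before] at this
  induction k generalizing m y with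
  | zero => simp [twoPhaseRun, daRun] at hy
  | succ k ih =>
    have hmA := mem_of_mem_pre_twoPhaseRun hk hy
    have ih := fun {m y} => ih (by omega) (m := m) (y := y)
    obtain ⟨z, hz, hzw⟩ := hwife m hmA
    refine ⟨z, hz, ?_, hzw⟩
    cases h : twoPhaseNext P.2 w A P.1 k with
    | none =>
      rw [twoPhaseRun_succ_of_none h] at hy
      obtain ⟨z', hz', h', -⟩ := ih hy
      rw [hz] at hz'
      rwa [Option.some.inj hz']
    | some p =>
      rw [twoPhaseRun_succ_of_some h, DAState.mem_pre_propose] at hy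
      rcases hy with hy | ⟨rfl, rfl⟩
      · obtain ⟨z', hz', h', -⟩ := ih hy
        rw [hz] at hz'
        rwa [Option.some.inj hz']
      -- A first man to go below his `η`-wife `z` was refused by her for some `m'` she prefers. By
      -- induction `m'` has not gone below his own `η`-wife, so he prefers `z` to her, and `m'` and
      -- `z` block `η`.
      · by_contra hlt
        rw [not_le] at hlt
        obtain ⟨-, hmove, hnext⟩ := twoPhaseNext_eq_some h
        set s := twoPhaseRun P.2 w A P.1 k with hs
        have hinv : s.Inv P.2 (fun x => x = w) P.1 := twoPhaseRun_inv k
        obtain ⟨hlen, hget⟩ := List.getElem?_eq_some_iff.1 hnext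
        have hidx : (P.1 p.1).1.idxOf p.2 = (s.pre p.1).length := by
          rw [← hget, (P.1 p.1).2.1.idxOf_getElem]
        have hzpre : z ∈ s.pre p.1 :=
          (hinv.pre_prefix p.1).mem_of_idxOf_lt_length (by omega)
        have hzne : z ≠ w := by
          rintro rfl
          simp [PrefList.Before] at hzw
        obtain ⟨m', hm', hb⟩ := hinv.best hzpre hzne
        have hne : p.1 ≠ m' := fun h => hmove.1 z (by rw [hm', h])
        obtain ⟨z', hz', hzz', -⟩ := ih (hinv.hold_mem hm').2
        refine hη m' z ⟨?_, ?_⟩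
        · rw [(η.consistent _ _).1 hz]
          intro b hb'
          rw [← Option.some.inj hb']
          exact (P.2 z).before_of_not_before hb hne
        · rw [hz']
          intro b hb'
          rw [← Option.some.inj hb']
          refine lt_of_le_of_ne hzz' fun heq => ?_
          rw [← (P.1 m').idxOf_inj heq] at hz'
          rw [η.consistent] at hz hz'
          rw [hz] at hz'
          exact hne (Option.some.inj hz')

/-- If a man `m₀` is a stable husband of `w`, then he proposes to `w` in the procedure. -/
theorem mem_pre_of_stable {P : Profile M W} {η : Matching M W} (hη : η.IsStable P) {m₀ : M}
    (hm₀ : η.husband w = some m₀) :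
    w ∈ (twoPhaseRun P.2 w A P.1 (daTime M W + daTime M W)).pre m₀ := by
  classical
  by_contra hw
  set s := twoPhaseRun P.2 w A P.1 (daTime M W + daTime M W) with hs
  have hinv : s.Inv P.2 (fun x => x = w) P.1 := twoPhaseRun_inv _
  have hend : ∀ m, ¬ s.CanMove m := fun m =>
    not_canMove_daRun (B := fun _ => True) (fun k _ => by
      funext a
      have : ¬ daTime M W + k < daTime M W := by omega
      simp [this]) trivial
  have hheld : ∀ {m x}, x ∉ s.pre m → ∃ y, s.hold y = some m ∧ (P.1 m).Before y x := by
    intro m x hx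
    by_cases h : ∃ y, s.hold y = some m
    · obtain ⟨y, hy⟩ := h
      refine ⟨y, hy, (P.1 m).before_of_not_before (fun h => hx ?_) ?_⟩
      · exact (hinv.pre_prefix m).mem_of_idxOf_lt (hinv.hold_mem hy).2 h
      · rintro rfl
        exact hx (hinv.hold_mem hy).2
    · push Not at h
      exact absurd (hinv.mem_pre_of_not_canMove (hend m) h x) hx
  -- Men who end up better than in `η`. The woman holding one of them has an `η`-husband whom she
  -- prefers, else `η` is blocked; he never proposed to her, so he too belongs to `S`. Thus the
  -- `η`-wives of `S` are exactly the women holding `S`. If `m₀` did not propose to `w`, he is in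
  -- `S`, and then `w` would hold a man.
  set S : Finset M := Finset.univ.filter fun m =>
    ∃ x, s.hold x = some m ∧ (P.1 m).Prefers x (η.wife m) with hS
  have hmem : ∀ {m}, m ∈ S ↔ ∃ x, s.hold x = some m ∧ (P.1 m).Prefers x (η.wife m) := by
    simp [hS]
  have hpref : ∀ {m x}, η.wife m = some x → x ∉ s.pre m → m ∈ S := by
    intro m x hmx hx
    obtain ⟨y, hy, hyx⟩ := hheld hx
    refine hmem.2 ⟨y, hy, ?_⟩
    rw [hmx]
    intro b hb
    rwa [← Option.some.inj hb]
  have : Nonempty W := ⟨w⟩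
  have hc : ∀ m ∈ S, ∃ x, s.hold x = some m ∧ (P.1 m).Prefers x (η.wife m) :=
    fun m h => hmem.1 h
  choose! κ hκ hκp using hc
  have hwife := (η.consistent _ _).2 hm₀
  obtain ⟨a, ha, h⟩ := η.exists_wife_eq_of_chain (S := S) (κ := κ) (fun a ha b hb hab => by
      have h1 := hκ a ha
      rw [hab, hκ b hb] at h1
      exact (Option.some.inj h1).symm) (fun a ha => by
      have h2 : ¬ (P.2 (κ a)).Prefers a (η.husband (κ a)) :=
        fun h => hη a (κ a) ⟨h, hκp a ha⟩
      simp only [PrefList.Prefers, not_forall] at h2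
      obtain ⟨b, hb, hab⟩ := h2
      have hbw := (η.consistent _ _).2 hb
      have hne : a ≠ b := by
        rintro rfl
        have := hκp a ha _ hbw
        simp [PrefList.Before] at this
      refine ⟨b, hpref hbw fun hpre => ?_, hb⟩
      obtain ⟨c, hc, hbc⟩ := hinv.best hpre (hinv.hold_mem (hκ a ha)).1
      rw [hκ a ha] at hc
      rw [← Option.some.inj hc] at hbc
      exact hbc ((P.2 (κ a)).before_of_not_before hab hne)) (hpref hwife hw)
  rw [hwife] at h
  have := (hinv.hold_mem (hκ a ha)).1
  exact this (Option.some.inj h).symm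

/-- Stability of `m₁` keeps `m₀` from reaching `w` in the first phase, while stability of `m₀` makes
him propose to her in the end. So he proposes in the second phase, which requires that some man of
`B` loses his woman to an outsider. -/
theorem exists_takesOver {P : Profile M W} {m₀ m₁ : M} (h₀ : IsStableHusband P w m₀)
    (h₁ : IsStableHusband P w m₁) (hA : A.card < Fintype.card W)
    (hAm : ∀ m ∈ A, (P.2 w).Before m m₁) {B : Finset M} (hB : B ⊆ A) (hm₀ : m₀ ∈ B) :
    ∃ k, daTime M W ≤ k ∧ k < daTime M W + daTime M W ∧ ∃ p, twoPhaseNext P.2 w A P.1 k = some p ∧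
      (twoPhaseRun P.2 w A P.1 k).TakesOver P.2 w B p := by
  obtain ⟨η₀, hη₀, hw₀⟩ := h₀
  obtain ⟨η₁, hη₁, hw₁⟩ := h₁
  by_contra hne
  have h := (pre_twoPhaseRun_eq (n := daTime M W + daTime M W) hA hB
    (fun k hk hk' p hp hto => hne ⟨k, hk, hk', p, hp, hto⟩) (Nat.le_add_right _ _) m₀ hm₀).1
  have hmem := mem_pre_of_stable (A := A) hη₀ hw₀
  rw [h] at hmem
  obtain ⟨z, -, hz, hzw⟩ := idxOf_le_of_mem_pre hη₁ hw₁ hAm le_rfl hmem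
  exact absurd hzw (not_lt.2 hz)

end TwoPhases

/-! ### Finite product laws, expected counts and conditioning -/

section Measurability

instance {α : Type*} (S : Finset α) : DiscreteMeasurableSpace (PrefList S) := ⟨fun _ => trivial⟩

instance {α : Type*} [Fintype α] (S : Finset α) : Finite (PrefList S) := by
  classical
  exact Finite.of_injective (fun l : PrefList S => (⟨l.1, l.2.1⟩ : {l : List α // l.Nodup}))
    fun a b h => Subtype.ext (by simpa using h)

/-- The law of independent preference lists. -/
noncomputable def listsLaw {ι α : Type*} [Fintype ι] [Fintype α] [DecidableEq α]
    (D : ι → Popularity α) : Measure (ι → PrefList (Finset.univ : Finset α)) :=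
  Measure.pi fun i => ((D i).listLaw Finset.univ).toMeasure

variable {ι α : Type*} [Fintype ι] [Fintype α] [DecidableEq α]

instance (D : ι → Popularity α) : IsProbabilityMeasure (listsLaw D) := by
  unfold listsLaw; infer_instance

theorem listsLaw_pi (D : ι → Popularity α)
    (E : ι → Set (PrefList (Finset.univ : Finset α))) :
    listsLaw D (Set.univ.pi E) = ∏ i, ((D i).listLaw Finset.univ).toOuterMeasure (E i) := by
  rw [listsLaw, Measure.pi_pi]
  exact Finset.prod_congr rfl fun i _ =>
    PMF.toMeasure_apply_eq_toOuterMeasure_apply _ (MeasurableSet.of_discrete)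

open scoped ENNReal

theorem sum_measure_le_sum_measure {Ω κ : Type*} [MeasurableSpace Ω] [DiscreteMeasurableSpace Ω]
    (μ : Measure Ω) {I : Finset κ} {S S' : κ → Set Ω}
    (h : ∀ ω, ∑ k ∈ I, (S k).indicator (1 : Ω → ℝ≥0∞) ω ≤ ∑ k ∈ I, (S' k).indicator 1 ω) :
    ∑ k ∈ I, μ (S k) ≤ ∑ k ∈ I, μ (S' k) := by
  have key : ∀ S : κ → Set Ω, ∑ k ∈ I, μ (S k) =
      ∫⁻ ω, ∑ k ∈ I, (S k).indicator (1 : Ω → ℝ≥0∞) ω ∂μ := by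
    intro S
    rw [lintegral_finsetSum I fun k _ => Measurable.of_discrete]
    exact Finset.sum_congr rfl fun k _ => (lintegral_indicator_one MeasurableSet.of_discrete).symm
  rw [key S, key S']
  exact lintegral_mono h

theorem sum_measure_le_of_forall {Ω κ : Type*} [MeasurableSpace Ω] [DiscreteMeasurableSpace Ω]
    (μ : Measure Ω) [IsProbabilityMeasure μ] {I : Finset κ} {S : κ → Set Ω} {c : ℝ≥0∞}
    (h : ∀ ω, ∑ k ∈ I, (S k).indicator (1 : Ω → ℝ≥0∞) ω ≤ c) :
    ∑ k ∈ I, μ (S k) ≤ c := by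
  have key : ∑ k ∈ I, μ (S k) = ∫⁻ ω, ∑ k ∈ I, (S k).indicator (1 : Ω → ℝ≥0∞) ω ∂μ := by
    rw [lintegral_finsetSum I fun k _ => Measurable.of_discrete]
    exact Finset.sum_congr rfl fun k _ => (lintegral_indicator_one MeasurableSet.of_discrete).symm
  rw [key]
  exact (lintegral_mono h).trans (by simp)

/-- Total probability: a comparison valid conditionally on each value of `F` holds unconditionally.
-/
theorem measure_le_of_fibers {Ω β : Type*} [Finite Ω] [MeasurableSpace Ω]
    [DiscreteMeasurableSpace Ω] (μ : Measure Ω) (F : Ω → β) {E E' : Set Ω} {a b : ℝ≥0∞}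
    (h : ∀ s, a * μ (F ⁻¹' {s} ∩ E) ≤ b * μ (F ⁻¹' {s} ∩ E')) : a * μ E ≤ b * μ E' := by
  classical
  have := Fintype.ofFinite Ω
  have key : ∀ E : Set Ω, μ E = ∑ s ∈ Finset.univ.image F, μ (F ⁻¹' {s} ∩ E) := by
    intro E
    have h1 := sum_measure_preimage_singleton (μ := μ.restrict E) (f := F) (Finset.univ.image F)
      (fun y _ => MeasurableSet.of_discrete)
    have h2 : F ⁻¹' (↑(Finset.univ.image F) : Set β) = Set.univ := by
      ext ω
      simp
    rw [h2, Measure.restrict_apply_univ] at h1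
    rw [← h1]
    exact Finset.sum_congr rfl fun s _ => Measure.restrict_apply MeasurableSet.of_discrete
  rw [key E, key E', Finset.mul_sum, Finset.mul_sum]
  exact Finset.sum_le_sum fun s _ => h s

end Measurability

/-! ### Deferred decisions: revealing the men's lists during the run -/

section Exploration

open scoped ENNReal

variable {M W : Type*} [Fintype M] [Fintype W] [DecidableEq M] [DecidableEq W]

/-- The profiles of lists with given initial segments. -/
def prefixBox (π : M → List W) : Set (M → PrefList (Finset.univ : Finset W)) :=
  {L | ∀ a, π a <+: (L a).1}

theorem listsLaw_prefixBox (DM : M → Popularity W) (π : M → List W) :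
    listsLaw DM (prefixBox π) = ∏ a, (DM a).prefixProb Finset.univ (π a) := by
  have : prefixBox π = Set.univ.pi fun a =>
      {l : PrefList (Finset.univ : Finset W) | π a <+: l.1} := by
    ext L; simp [prefixBox]
  rw [this, listsLaw_pi]
  rfl

variable {DM : M → Popularity W}

theorem le_maxRatio [Nonempty M] [Nonempty W] (m : M) (x y : W) :
    DM m x / DM m y ≤ maxRatio DM :=
  Finset.le_sup' (fun t : M × W × W => DM t.1 t.2.1 / DM t.1 t.2.2) (Finset.mem_univ (m, x, y))

theorem one_le_maxRatio [Nonempty M] [Nonempty W] : 1 ≤ maxRatio DM := by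
  obtain ⟨m⟩ := ‹Nonempty M›
  obtain ⟨x⟩ := ‹Nonempty W›
  have := le_maxRatio (DM := DM) m x x
  rwa [div_self ((DM m).pos x).ne'] at this

/-- Two possible next entries of a list have comparable probabilities. -/
theorem listsLaw_prefixBox_le [Nonempty M] [Nonempty W] (π : M → List W) (m : M) (x : W) {y : W}
    (hy : y ∉ π m) :
    listsLaw DM (prefixBox (Function.update π m (π m ++ [x]))) ≤
      ENNReal.ofReal (maxRatio DM) *
        listsLaw DM (prefixBox (Function.update π m (π m ++ [y]))) := by
  have key : ∀ z, listsLaw DM (prefixBox (Function.update π m (π m ++ [z]))) =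
      (DM m).prefixProb Finset.univ (π m ++ [z]) *
        ∏ a ∈ Finset.univ.erase m, (DM a).prefixProb Finset.univ (π a) := by
    intro z
    rw [listsLaw_prefixBox, ← Finset.mul_prod_erase _ _ (Finset.mem_univ m)]
    congr 1
    · simp
    · refine Finset.prod_congr rfl fun a ha => ?_
      rw [Function.update_of_ne (Finset.ne_of_mem_erase ha)]
  rw [key, key, ← mul_assoc]
  refine mul_le_mul_left ?_ _
  by_cases hx : x ∈ π m
  · rw [(DM m).prefixProb_append_of_mem hx]
    exact zero_le
  · have h := (DM m).prefixProb_append (π m) (Finset.mem_univ x) (Finset.mem_univ y) hx hy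
    have hypos : ENNReal.ofReal (DM m y) ≠ 0 := by
      simpa using (DM m).pos y
    rw [← ENNReal.mul_le_mul_iff_left hypos ENNReal.ofReal_ne_top, h, mul_right_comm,
      mul_comm ((DM m).prefixProb _ _), ← ENNReal.ofReal_mul (zero_le_one.trans one_le_maxRatio)]
    refine mul_le_mul_left (ENNReal.ofReal_le_ofReal ?_) _
    have := le_maxRatio (DM := DM) m x y
    rwa [div_le_iff₀ ((DM m).pos y)] at this

variable {LW : W → PrefList (Finset.univ : Finset M)} {w : W} {A : Finset M}

/-- The choice of the mover depends only on the state, and a list is read only through the proposals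
made. So the unread parts of the lists are still free given the state. -/
theorem twoPhaseRun_congr {L L' : M → PrefList (Finset.univ : Finset W)} {k : ℕ}
    (h : L' ∈ prefixBox (twoPhaseRun LW w A L k).pre) :
    twoPhaseRun LW w A L' k = twoPhaseRun LW w A L k := by
  induction k with
  | zero => rfl
  | succ k ih =>
    cases hn : twoPhaseNext LW w A L k with
    | none =>
      rw [twoPhaseRun_succ_of_none hn] at h ⊢
      have hk := ih h
      have hn' : twoPhaseNext LW w A L' k = none := by
        cases hn' : twoPhaseNext LW w A L' k with
        | none => rfl
        | some p =>
          have h1 := twoPhaseNext_eq_some hn'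
          rw [hk] at h1
          exact absurd h1.2.1 (DAState.next_eq_none hn h1.1)
      rw [twoPhaseRun_succ_of_none hn', hk]
    | some p =>
      obtain ⟨m, x⟩ := p
      have h1 := twoPhaseNext_eq_some hn
      rw [twoPhaseRun_succ_of_some hn] at h ⊢
      have hbox : L' ∈ prefixBox (twoPhaseRun LW w A L k).pre := by
        intro a
        have ha := h a
        by_cases hm : a = m
        · subst hm
          simp only [DAState.propose, Function.update_self] at ha
          exact (List.prefix_append _ _).trans ha
        · simpa [DAState.propose, hm] using ha
      have hk := ih hbox
      have hn' : twoPhaseNext LW w A L' k = some (m, x) := by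
        rw [twoPhaseNext, DAState.next_eq_some, hk]
        refine ⟨(DAState.next_eq_some.1 hn).1,
          (List.append_singleton_prefix_iff (hbox m) x).1 ?_⟩
        simpa [DAState.propose] using h m
      rw [twoPhaseRun_succ_of_some hn', hk]

/-- The event that a man outside of `B` takes over a woman from a man of `B` at time `k`. -/
def crossEvent (LW : W → PrefList (Finset.univ : Finset M)) (w : W) (A B : Finset M) (k : ℕ) :
    Set (M → PrefList (Finset.univ : Finset W)) :=
  {L | ∃ p, twoPhaseNext LW w A L k = some p ∧ (twoPhaseRun LW w A L k).TakesOver LW w B p}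

/-- The event that at time `k` a man of `A'` proposes to a woman not held by a man of `A''`. -/
def landEvent (LW : W → PrefList (Finset.univ : Finset M)) (w : W) (A A' A'' : Finset M) (k : ℕ) :
    Set (M → PrefList (Finset.univ : Finset W)) :=
  {L | ∃ p, twoPhaseNext LW w A L k = some p ∧ p.1 ∈ A' ∧ p.2 ≠ w ∧
    ∀ m ∈ A'', (twoPhaseRun LW w A L k).hold p.2 ≠ some m}

/-- All women prefer the men of `X` to the men outside of `Y`. -/
def Dominates (LW : W → PrefList (Finset.univ : Finset M)) (X Y : Finset M) : Prop :=
  ∀ x, ∀ m ∈ X, ∀ m' ∉ Y, (LW x).Before m m'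

theorem PrefList.Before.asymm {α : Type*} [DecidableEq α] {S : Finset α} {l : PrefList S} {a b : α}
    (h : l.Before a b) : ¬ l.Before b a := by
  simp only [PrefList.Before] at h ⊢
  omega

/-- Given the state, the mover `m` is determined and only his next entry is random. In a takeover
from `C` he belongs to `C'`, since women prefer `C` to the men outside `C'`, and the abandoned man
is not in `B`, since women prefer `B` to the men outside `C`. This leaves at most `(C \ B).card`
targets. To a woman other than `w` not held by `C''` he has not yet proposed, as she would hold
someone at least as good. Each such woman is a possible next entry, at most `R` times less likely
than a target. -/
theorem mul_crossEvent_le [Nonempty M] [Nonempty W] {B C C' C'' : Finset M}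
    (hBC : Dominates LW B C) (hCC : Dominates LW C C') (hCC' : Dominates LW C' C'')
    (hsub : C' ⊆ C'') (hu : C''.card ≤ Fintype.card W) (k : ℕ) :
    ((Fintype.card W - C''.card : ℕ) : ℝ≥0∞) * listsLaw DM (crossEvent LW w A C k) ≤
      (ENNReal.ofReal (maxRatio DM) * ((C \ B).card : ℝ≥0∞)) *
        listsLaw DM (landEvent LW w A C' C'' k) := by
  classical
  refine measure_le_of_fibers _ (fun L => twoPhaseRun LW w A L k) fun s => ?_
  rcases Set.eq_empty_or_nonempty
    ((fun L => twoPhaseRun LW w A L k) ⁻¹' {s} ∩ crossEvent LW w A C k) with h | ⟨L₀, hL₀, hc⟩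
  · rw [h]
    simp
  simp only [Set.mem_preimage, Set.mem_singleton_iff] at hL₀
  obtain ⟨⟨m, x₀⟩, hnext, hmC, hacc, m₀, hm₀, hhold⟩ := hc
  obtain ⟨hact, hmove, hget⟩ := twoPhaseNext_eq_some hnext
  have hmov := (DAState.next_eq_some.1 hnext).1
  have hinv : (twoPhaseRun LW w A L₀ k).Inv LW (fun x => x = w) L₀ := twoPhaseRun_inv k
  rw [hL₀] at hacc hhold hmove hget hmov hinv
  simp only at hmC hacc hhold
  have hmC' : m ∈ C' := by
    by_contra hm
    exact (hCC x₀ m₀ hm₀ m hm).asymm (hacc.2 m₀ hhold)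
  set box : W → Set (M → PrefList (Finset.univ : Finset W)) := fun x =>
    prefixBox (Function.update s.pre m (s.pre m ++ [x])) with hbox
  have hnextiff : ∀ L, twoPhaseRun LW w A L k = s → ∀ m' x,
      twoPhaseNext LW w A L k = some (m', x) ↔ m' = m ∧ L ∈ box x := by
    intro L hL m' x
    have hinvL : s.Inv LW (fun x => x = w) L := hL ▸ twoPhaseRun_inv k
    rw [twoPhaseNext, DAState.next_eq_some, hL, hmov]
    constructor
    · rintro ⟨h1, h2⟩
      obtain rfl := Option.some.inj h1
      refine ⟨rfl, fun a => ?_⟩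
      by_cases ha : a = m
      · subst ha
        rw [Function.update_self]
        exact (List.append_singleton_prefix_iff (hinvL.pre_prefix a) x).2 h2
      · rw [Function.update_of_ne ha]
        exact hinvL.pre_prefix a
    · rintro ⟨rfl, h2⟩
      refine ⟨rfl, (List.append_singleton_prefix_iff (hinvL.pre_prefix m') x).1 ?_⟩
      simpa using h2 m'
  have hrun : ∀ {L x}, L ∈ box x → twoPhaseRun LW w A L k = s := by
    intro L x hL
    rw [← hL₀]
    refine twoPhaseRun_congr fun a => ?_
    rw [hL₀]
    have := hL a
    by_cases ha : a = m
    · subst ha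
      rw [Function.update_self] at this
      exact (List.prefix_append _ _).trans this
    · rwa [Function.update_of_ne ha] at this
  set V : Finset W := Finset.univ.filter fun x => ∃ m' ∈ C \ B, s.hold x = some m' with hV
  set U : Finset W := Finset.univ.filter fun y => y ≠ w ∧ ∀ m' ∈ C'', s.hold y ≠ some m' with hU
  have hVcard : V.card ≤ (C \ B).card := by
    have : ∀ x ∈ V, ∃ m' ∈ C \ B, s.hold x = some m' := fun x hx => (Finset.mem_filter.1 hx).2
    choose! f hf hf' using this
    refine Finset.card_le_card_of_injOn f hf fun x hx y hy hxy => ?_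
    have h1 := hf' x hx
    rw [hxy] at h1
    exact hinv.hold_inj h1 (hf' y hy)
  -- The mover lies in `C''` and is not held, so `C''` holds at most `C''.card - 1` women; this
  -- compensates for the exclusion of `w`.
  have hUcard : Fintype.card W - C''.card ≤ U.card := by
    set V' : Finset W := Finset.univ.filter fun x => ∃ m' ∈ C'', s.hold x = some m' with hV'
    have h1 : V'.card ≤ (C''.erase m).card := by
      have : ∀ x ∈ V', ∃ m' ∈ C'', s.hold x = some m' := fun x hx => (Finset.mem_filter.1 hx).2
      choose! f hf hf' using this
      refine Finset.card_le_card_of_injOn f (fun x hx => ?_) fun x hx y hy hxy => ?_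
      · rw [Finset.mem_coe, Finset.mem_erase]
        exact ⟨fun h => hmove.1 x (by rw [hf' x hx, h]), hf x hx⟩
      · have h1 := hf' x hx
        rw [hxy] at h1
        exact hinv.hold_inj h1 (hf' y hy)
    have h2 : (Finset.univ : Finset W) ⊆ insert w (V' ∪ U) := by
      intro x _
      simp only [hV', hU, Finset.mem_insert, Finset.mem_union, Finset.mem_filter, Finset.mem_univ,
        true_and]
      by_cases hx : x = w
      · exact Or.inl hx
      · by_cases hx' : ∃ m' ∈ C'', s.hold x = some m'
        · exact Or.inr (Or.inl hx')
        · push Not at hx'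
          exact Or.inr (Or.inr ⟨hx, hx'⟩)
    have h3 := (Finset.card_le_card h2).trans ((Finset.card_insert_le _ _).trans
      (Nat.succ_le_succ (Finset.card_union_le _ _)))
    rw [Finset.card_erase_of_mem (hsub hmC')] at h1
    have := Finset.card_pos.2 ⟨m, hsub hmC'⟩
    rw [Finset.card_univ] at h3
    omega
  have hUpre : ∀ y ∈ U, y ∉ s.pre m := by
    intro y hy hpre
    obtain ⟨hyw, hyC⟩ := (Finset.mem_filter.1 hy).2
    obtain ⟨m', hm', hb⟩ := hinv.best hpre hyw
    exact hb (hCC' y m hmC' m' fun h => hyC m' h hm')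
  have hcross : (fun L => twoPhaseRun LW w A L k) ⁻¹' {s} ∩ crossEvent LW w A C k ⊆
      ⋃ x ∈ V, box x := by
    rintro L ⟨hL, ⟨m', x⟩, hp, -, hacc', m₁, hm₁, hh⟩
    simp only [Set.mem_preimage, Set.mem_singleton_iff] at hL
    obtain ⟨rfl, hx⟩ := (hnextiff L hL m' x).1 hp
    rw [hL] at hacc' hh
    refine Set.mem_iUnion₂.2 ⟨x, ?_, hx⟩
    rw [hV, Finset.mem_filter]
    refine ⟨Finset.mem_univ _, m₁, Finset.mem_sdiff.2 ⟨hm₁, fun hB => ?_⟩, hh⟩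
    exact (hBC x m₁ hB m' hmC).asymm (hacc'.2 m₁ hh)
  have hland : ⋃ y ∈ U, box y ⊆
      (fun L => twoPhaseRun LW w A L k) ⁻¹' {s} ∩ landEvent LW w A C' C'' k := by
    intro L hL
    obtain ⟨y, hy, hLy⟩ := Set.mem_iUnion₂.1 hL
    have hLs := hrun hLy
    obtain ⟨hyw, hyC⟩ := (Finset.mem_filter.1 hy).2
    refine ⟨hLs, (m, y), (hnextiff L hLs m y).2 ⟨rfl, hLy⟩, hmC', hyw, ?_⟩
    rw [hLs]
    exact hyC
  have hdisj : (U : Set W).PairwiseDisjoint box := by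
    intro x _ y _ hxy
    refine Set.disjoint_left.2 fun L hx hy => hxy ?_
    have h1 := (hnextiff L (hrun hx) m x).2 ⟨rfl, hx⟩
    rw [(hnextiff L (hrun hx) m y).2 ⟨rfl, hy⟩] at h1
    exact (Prod.mk.inj (Option.some.inj h1)).2.symm
  have hsum : ∑ y ∈ U, listsLaw DM (box y) ≤ listsLaw DM
      ((fun L => twoPhaseRun LW w A L k) ⁻¹' {s} ∩ landEvent LW w A C' C'' k) := by
    rw [← measure_biUnion_finset hdisj fun _ _ => MeasurableSet.of_discrete]
    exact measure_mono hland
  have hx : ∀ x, (U.card : ℝ≥0∞) * listsLaw DM (box x) ≤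
      ENNReal.ofReal (maxRatio DM) * ∑ y ∈ U, listsLaw DM (box y) := by
    intro x
    rw [← nsmul_eq_mul, ← Finset.sum_const, Finset.mul_sum]
    exact Finset.sum_le_sum fun y hy => listsLaw_prefixBox_le s.pre m x (hUpre y hy)
  calc _ ≤ (U.card : ℝ≥0∞) * ∑ x ∈ V, listsLaw DM (box x) :=
        mul_le_mul' (by exact_mod_cast hUcard)
          ((measure_mono hcross).trans (measure_biUnion_finset_le _ _))
    _ ≤ ∑ x ∈ V, ENNReal.ofReal (maxRatio DM) * ∑ y ∈ U, listsLaw DM (box y) := by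
        rw [Finset.mul_sum]
        exact Finset.sum_le_sum fun x _ => hx x
    _ = (ENNReal.ofReal (maxRatio DM) * (V.card : ℝ≥0∞)) * ∑ y ∈ U, listsLaw DM (box y) := by
        rw [Finset.sum_const, nsmul_eq_mul]
        ring
    _ ≤ _ := mul_le_mul' (mul_le_mul_right (by exact_mod_cast hVcard) _) hsum

end Exploration

/-! ### Pathwise balance of landings and takeovers -/

section Counting

open scoped ENNReal

variable {M W : Type*} [Fintype M] [Fintype W] [DecidableEq M] [DecidableEq W]

variable {LW : W → PrefList (Finset.univ : Finset M)} {w : W} {A : Finset M}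
  {L : M → PrefList (Finset.univ : Finset W)}

open Classical in
/-- The women held by a man of `C`. -/
noncomputable def DAState.heldBy (s : DAState M W) (C : Finset M) : Finset W :=
  Finset.univ.filter fun x => ∃ m ∈ C, s.hold x = some m

theorem DAState.mem_heldBy {s : DAState M W} {C : Finset M} {x : W} :
    x ∈ s.heldBy C ↔ ∃ m ∈ C, s.hold x = some m := by
  simp [DAState.heldBy]

theorem DAState.Inv.card_heldBy_le {ex : W → Prop} {s : DAState M W} (hs : s.Inv LW ex L)
    (C : Finset M) : (s.heldBy C).card ≤ C.card := by
  have : ∀ x ∈ s.heldBy C, ∃ m' ∈ C, s.hold x = some m' := fun x hx => DAState.mem_heldBy.1 hx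
  rcases isEmpty_or_nonempty M with h | h
  · rw [Finset.card_eq_zero.2]
    · exact Nat.zero_le _
    · refine Finset.eq_empty_of_forall_notMem fun x hx => ?_
      obtain ⟨m, -⟩ := this x hx
      exact h.elim m
  choose! f hf hf' using this
  refine Finset.card_le_card_of_injOn f hf fun x hx y hy hxy => ?_
  have h1 := hf' x hx
  rw [hxy] at h1
  exact hs.hold_inj h1 (hf' y hy)

theorem card_le_card_heldBy (hA : A.card < Fintype.card W) {C : Finset M} (hC : C ⊆ A) :
    C.card ≤ ((twoPhaseRun LW w A L (daTime M W)).heldBy C).card := by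
  have : ∀ m ∈ C, ∃ x, (twoPhaseRun LW w A L (daTime M W)).hold x = some m :=
    fun m hm => exists_hold_of_mem hA (hC hm)
  have : Nonempty W := ⟨w⟩
  choose! f hf using ‹∀ m ∈ C, ∃ x, (twoPhaseRun LW w A L (daTime M W)).hold x = some m›
  refine Finset.card_le_card_of_injOn f (fun m hm => ?_) fun a ha b hb hab => ?_
  · exact DAState.mem_heldBy.2 ⟨m, hm, hf m hm⟩
  · have h1 := hf a ha
    rw [hab, hf b hb] at h1
    exact (Option.some.inj h1).symm

/-- By domination a landing is accepted and adds a woman to those held by `C''`; only a takeover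
from `C''` can remove one. -/
theorem card_heldBy_add_land_le {C' C'' : Finset M} (hdom : Dominates LW C' C'')
    (hsub : C' ⊆ C'') (k : ℕ) :
    (((twoPhaseRun LW w A L k).heldBy C'').card : ℝ≥0∞) +
        (landEvent LW w A C' C'' k).indicator 1 L ≤
      (((twoPhaseRun LW w A L (k + 1)).heldBy C'').card : ℝ≥0∞) +
        (crossEvent LW w A C'' k).indicator 1 L := by
  classical
  have hinv := twoPhaseRun_inv (LW := LW) (w := w) (A := A) (L := L) k
  cases hn : twoPhaseNext LW w A L k with
  | none =>
    rw [twoPhaseRun_succ_of_none hn, Set.indicator_of_notMem]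
    · rw [add_zero]
      exact le_self_add
    · rintro ⟨p, hp, -⟩
      rw [hn] at hp
      simp at hp
  | some p =>
    have hs := twoPhaseRun_succ_of_some hn
    set s := twoPhaseRun LW w A L k with hsdef
    rw [hs]
    by_cases hl : L ∈ landEvent LW w A C' C'' k
    · rw [Set.indicator_of_mem hl]
      obtain ⟨q, hq, hqC, hqw, hqh⟩ := hl
      rw [hn] at hq
      obtain rfl := Option.some.inj hq
      have hacc : s.Accepts LW (fun x => x = w) p.1 p.2 :=
        ⟨hqw, fun b hb => hdom p.2 p.1 hqC b fun h => hqh b h hb⟩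
      have hnot : p.2 ∉ s.heldBy C'' := fun h => by
        obtain ⟨b, hb, hb'⟩ := DAState.mem_heldBy.1 h
        exact hqh b hb hb'
      have hsubset : insert p.2 (s.heldBy C'') ⊆
          (s.propose LW (fun x => x = w) p.1 p.2).heldBy C'' := by
        intro y hy
        rw [DAState.mem_heldBy, DAState.hold_propose_of_accepts hacc]
        rcases Finset.mem_insert.1 hy with rfl | hy
        · exact ⟨p.1, hsub hqC, by simp⟩
        · rw [if_neg (fun h : y = p.2 => hnot (h ▸ hy))]
          exact DAState.mem_heldBy.1 hy
      have := Finset.card_le_card hsubset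
      rw [Finset.card_insert_of_notMem hnot] at this
      refine le_trans ?_ (le_self_add (b := (crossEvent LW w A C'' k).indicator 1 L))
      rw [Pi.one_apply]
      exact_mod_cast this
    · rw [Set.indicator_of_notMem hl, add_zero]
      have hstay : ∀ y ∈ s.heldBy C'', (y = p.2 → ¬ s.TakesOver LW w C'' p) →
          y ∈ (s.propose LW (fun x => x = w) p.1 p.2).heldBy C'' := by
        intro y hy hto
        obtain ⟨b, hb, hb'⟩ := DAState.mem_heldBy.1 hy
        rw [DAState.mem_heldBy]
        by_cases hacc : s.Accepts LW (fun x => x = w) p.1 p.2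
        · rw [DAState.hold_propose_of_accepts hacc]
          split_ifs with h
          · subst h
            refine ⟨p.1, ?_, rfl⟩
            by_contra hp
            exact hto rfl ⟨hp, hacc, b, hb, hb'⟩
          · exact ⟨b, hb, hb'⟩
        · rw [DAState.hold_propose_of_not_accepts hacc]
          exact ⟨b, hb, hb'⟩
      by_cases hc : L ∈ crossEvent LW w A C'' k
      · rw [Set.indicator_of_mem hc, Pi.one_apply]
        have hsubset : s.heldBy C'' ⊆
            insert p.2 ((s.propose LW (fun x => x = w) p.1 p.2).heldBy C'') := by
          intro y hy
          by_cases h : y = p.2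
          · exact Finset.mem_insert.2 (Or.inl h)
          · exact Finset.mem_insert_of_mem (hstay y hy fun h' => absurd h' h)
        exact_mod_cast (Finset.card_le_card hsubset).trans (Finset.card_insert_le _ _)
      · refine le_trans ?_ le_self_add
        exact_mod_cast Finset.card_le_card fun y hy =>
          hstay y hy fun _ hto => hc ⟨p, hn, hto⟩

/-- Pathwise, there are at most as many landings outside of `C''` as takeovers from `C''`. -/
theorem sum_land_le_sum_cross (hA : A.card < Fintype.card W) {C' C'' : Finset M}
    (hdom : Dominates LW C' C'') (hsub : C' ⊆ C'') (hC : C'' ⊆ A) (n : ℕ) :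
    ∑ k ∈ Finset.Ico (daTime M W) n, (landEvent LW w A C' C'' k).indicator (1 : (M → PrefList (Finset.univ : Finset W)) → ℝ≥0∞) L ≤
      ∑ k ∈ Finset.Ico (daTime M W) n, (crossEvent LW w A C'' k).indicator 1 L := by
  rcases le_or_gt n (daTime M W) with hn | hn
  · simp [Finset.Ico_eq_empty_of_le hn]
  -- After the first phase all men of `C''` are held. As `C''` can never hold more than `C''.card`
  -- women, every later gain is matched by a loss.
  have key : ∀ n, daTime M W ≤ n → (C''.card : ℝ≥0∞) + ∑ k ∈ Finset.Ico (daTime M W) n,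
      (landEvent LW w A C' C'' k).indicator (1 : (M → PrefList (Finset.univ : Finset W)) → ℝ≥0∞) L ≤
      (((twoPhaseRun LW w A L n).heldBy C'').card : ℝ≥0∞) +
      ∑ k ∈ Finset.Ico (daTime M W) n, (crossEvent LW w A C'' k).indicator 1 L := by
    intro n hn
    induction n, hn using Nat.le_induction with
    | base =>
      simp only [Finset.Ico_self, Finset.sum_empty, add_zero]
      exact_mod_cast card_le_card_heldBy hA hC
    | succ n hn ih =>
      rw [Finset.sum_Ico_succ_top hn, Finset.sum_Ico_succ_top hn, ← add_assoc]
      refine (add_le_add_left ih _).trans ?_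
      rw [add_right_comm]
      refine (add_le_add_left (card_heldBy_add_land_le hdom hsub n) _).trans ?_
      rw [add_assoc, add_comm ((crossEvent LW w A C'' n).indicator 1 L)]
  have h1 := (key n hn.le).trans (add_le_add_left (show
    (((twoPhaseRun LW w A L n).heldBy C'').card : ℝ≥0∞) ≤ C''.card by
      exact_mod_cast (twoPhaseRun_inv n).card_heldBy_le C'') _)
  exact (ENNReal.add_le_add_iff_left (ENNReal.natCast_ne_top _)).1 h1

/-- Pathwise, there are at most `C''.card` landings outside of `C''`. -/
theorem sum_land_le_card {C' C'' : Finset M} (hdom : Dominates LW C' C'') {a n : ℕ} (hn : a ≤ n) :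
    ∑ k ∈ Finset.Ico a n, (landEvent LW w A C' C'' k).indicator (1 : (M → PrefList (Finset.univ : Finset W)) → ℝ≥0∞) L ≤ C''.card := by
  classical
  -- The women other than `w` already addressed by `C'` are all held by `C''`, by domination; each
  -- landing adds a new one.
  set G : ℕ → Finset W := fun k =>
    Finset.univ.filter fun x => x ≠ w ∧ ∃ m ∈ C', x ∈ (twoPhaseRun LW w A L k).pre m with hG
  have hmem : ∀ {k x}, x ∈ G k ↔ x ≠ w ∧ ∃ m ∈ C', x ∈ (twoPhaseRun LW w A L k).pre m := by
    simp [hG]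
  have hGheld : ∀ k, G k ⊆ (twoPhaseRun LW w A L k).heldBy C'' := by
    intro k x hx
    obtain ⟨hxw, m, hm, hxm⟩ := hmem.1 hx
    obtain ⟨m', hm', hb⟩ := (twoPhaseRun_inv k).best hxm hxw
    refine DAState.mem_heldBy.2 ⟨m', ?_, hm'⟩
    by_contra h
    exact hb (hdom x m hm m' h)
  have hstep : ∀ k, ((G k).card : ℝ≥0∞) + (landEvent LW w A C' C'' k).indicator 1 L ≤
      (G (k + 1)).card := by
    intro k
    cases hn : twoPhaseNext LW w A L k with
    | none =>
      have : G (k + 1) = G k := by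
        simp only [hG, twoPhaseRun_succ_of_none hn]
      rw [this, Set.indicator_of_notMem, add_zero]
      rintro ⟨p, hp, -⟩
      rw [hn] at hp
      simp at hp
    | some p =>
      have hsub : G k ⊆ G (k + 1) := by
        intro x hx
        obtain ⟨hxw, m, hm, hxm⟩ := hmem.1 hx
        refine hmem.2 ⟨hxw, m, hm, ?_⟩
        rw [twoPhaseRun_succ_of_some hn, DAState.mem_pre_propose]
        exact Or.inl hxm
      by_cases hl : L ∈ landEvent LW w A C' C'' k
      · rw [Set.indicator_of_mem hl, Pi.one_apply]
        obtain ⟨q, hq, hqC, hqw, hqh⟩ := hl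
        rw [hn] at hq
        obtain rfl := Option.some.inj hq
        have hnot : p.2 ∉ G k := fun h => by
          obtain ⟨m, hm, hm'⟩ := DAState.mem_heldBy.1 (hGheld k h)
          exact hqh m hm hm'
        have hins : insert p.2 (G k) ⊆ G (k + 1) := by
          refine Finset.insert_subset (hmem.2 ⟨hqw, p.1, hqC, ?_⟩) hsub
          rw [twoPhaseRun_succ_of_some hn, DAState.mem_pre_propose]
          exact Or.inr ⟨rfl, rfl⟩
        have := Finset.card_le_card hins
        rw [Finset.card_insert_of_notMem hnot] at this
        exact_mod_cast this
      · rw [Set.indicator_of_notMem hl, add_zero]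
        exact_mod_cast Finset.card_le_card hsub
  have key : ∑ k ∈ Finset.Ico a n, (landEvent LW w A C' C'' k).indicator (1 : (M → PrefList (Finset.univ : Finset W)) → ℝ≥0∞) L ≤
      (G n).card := by
    induction n, hn using Nat.le_induction with
    | base => simp
    | succ n hn ih =>
      rw [Finset.sum_Ico_succ_top hn]
      exact (add_le_add_left ih _).trans (hstep n)
  refine key.trans ?_
  exact_mod_cast (Finset.card_le_card (hGheld n)).trans ((twoPhaseRun_inv n).card_heldBy_le C'')

end Counting

/-! ### Recursion for the expected number of takeovers -/

section Recursion

open scoped ENNReal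

variable {M W : Type*} [Fintype M] [Fintype W] [DecidableEq M] [DecidableEq W]
  [Nonempty M] [Nonempty W] {DM : M → Popularity W}
  {LW : W → PrefList (Finset.univ : Finset M)} {w : W} {A : Finset M}

/-- The expected number of takeovers from `C` in the second phase. -/
noncomputable def expectedCross (DM : M → Popularity W)
    (LW : W → PrefList (Finset.univ : Finset M)) (w : W) (A C : Finset M) : ℝ≥0∞ :=
  ∑ k ∈ Finset.Ico (daTime M W) (daTime M W + daTime M W), listsLaw DM (crossEvent LW w A C k)

theorem mul_expectedCross_le {B C C' C'' : Finset M} (hA : A.card < Fintype.card W)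
    (hBC : Dominates LW B C) (hCC : Dominates LW C C') (hCC' : Dominates LW C' C'')
    (hsub : C' ⊆ C'') (hC : C'' ⊆ A) :
    ((Fintype.card W - C''.card : ℕ) : ℝ≥0∞) * expectedCross DM LW w A C ≤
      (ENNReal.ofReal (maxRatio DM) * ((C \ B).card : ℝ≥0∞)) *
        min (expectedCross DM LW w A C'') C''.card := by
  have h1 : ((Fintype.card W - C''.card : ℕ) : ℝ≥0∞) * expectedCross DM LW w A C ≤
      (ENNReal.ofReal (maxRatio DM) * ((C \ B).card : ℝ≥0∞)) *
        ∑ k ∈ Finset.Ico (daTime M W) (daTime M W + daTime M W),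
          listsLaw DM (landEvent LW w A C' C'' k) := by
    rw [expectedCross, Finset.mul_sum, Finset.mul_sum]
    exact Finset.sum_le_sum fun k _ => mul_crossEvent_le hBC hCC hCC' hsub
      ((Finset.card_le_card hC).trans hA.le) k
  refine h1.trans (mul_le_mul_right (le_min ?_ ?_) _)
  · exact sum_measure_le_sum_measure _ fun L => sum_land_le_sum_cross hA hCC' hsub hC _
  · exact sum_measure_le_of_forall _ fun L => sum_land_le_card hCC' (Nat.le_add_right _ _)

theorem expectedCross_ne_top {C : Finset M} : expectedCross DM LW w A C ≠ ⊤ :=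
  ENNReal.sum_ne_top.2 fun _ _ => measure_ne_top _ _

/-- Four consecutive layers `C (2k), …, C (2k+3)` link the takeovers from `C (2k+1)` to those from
`C (2k+3)`. The last link uses instead that landings are bounded by the size of the set. -/
theorem expectedCross_le_prod {C : ℕ → Finset M} (hmono : Monotone C) {r : ℕ} (hr : 0 < r)
    (hA : (C (2 * r + 1)).card < Fintype.card W)
    (hdom : ∀ i ≤ 2 * r, Dominates LW (C i) (C (i + 1))) :
    (expectedCross DM LW w (C (2 * r + 1)) (C 1)).toReal ≤
      (∏ k ∈ Finset.range r, (maxRatio DM * ((C (2 * k + 1) \ C (2 * k)).card : ℝ) /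
        ((Fintype.card W : ℝ) - (C (2 * k + 3)).card))) * (C (2 * r + 1)).card := by
  set A := C (2 * r + 1) with hAdef
  set x : ℕ → ℝ := fun k => (expectedCross DM LW w A (C (2 * k + 1))).toReal with hx
  set ρ : ℕ → ℝ := fun k => maxRatio DM * ((C (2 * k + 1) \ C (2 * k)).card : ℝ) /
        ((Fintype.card W : ℝ) - (C (2 * k + 3)).card) with hρ
  have hle : ∀ k < r, (C (2 * k + 3)).card < Fintype.card W := fun k hk =>
    (Finset.card_le_card (hmono (by omega))).trans_lt hA
  have hR : 0 ≤ maxRatio DM := zero_le_one.trans one_le_maxRatio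
  have hpos : ∀ k < r, (0 : ℝ) < (Fintype.card W : ℝ) - (C (2 * k + 3)).card := fun k hk =>
    sub_pos.2 (by exact_mod_cast hle k hk)
  have hρ0 : ∀ k < r, 0 ≤ ρ k := fun k hk =>
    div_nonneg (mul_nonneg hR (Nat.cast_nonneg _)) (hpos k hk).le
  have hstep : ∀ k < r, x k ≤ ρ k * x (k + 1) ∧ x k ≤ ρ k * (C (2 * k + 3)).card := by
    intro k hk
    have h := mul_expectedCross_le (DM := DM) (w := w) hA (hdom (2 * k) (by omega))
      (hdom (2 * k + 1) (by omega)) (hdom (2 * k + 2) (by omega)) (hmono (by omega))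
      (hmono (show 2 * k + 2 + 1 ≤ 2 * r + 1 by omega))
    have h' := ENNReal.toReal_mono (ENNReal.mul_ne_top (ENNReal.mul_ne_top ENNReal.ofReal_ne_top
      (ENNReal.natCast_ne_top _)) (ne_top_of_le_ne_top (ENNReal.natCast_ne_top _)
        (min_le_right _ _))) h
    rw [ENNReal.toReal_mul, ENNReal.toReal_mul, ENNReal.toReal_mul, ENNReal.toReal_ofReal hR,
      ENNReal.toReal_natCast, ENNReal.toReal_natCast, Nat.cast_sub (hle k hk).le,
      ENNReal.toReal_min expectedCross_ne_top (ENNReal.natCast_ne_top _),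
      ENNReal.toReal_natCast] at h'
    have h0 : 0 ≤ maxRatio DM * ((C (2 * k + 1) \ C (2 * k)).card : ℝ) :=
      mul_nonneg hR (Nat.cast_nonneg _)
    constructor
    · rw [hρ, div_mul_eq_mul_div, le_div_iff₀ (hpos k hk), mul_comm]
      exact h'.trans (mul_le_mul_of_nonneg_left (min_le_left _ _) h0)
    · rw [hρ, div_mul_eq_mul_div, le_div_iff₀ (hpos k hk), mul_comm]
      exact h'.trans (mul_le_mul_of_nonneg_left (min_le_right _ _) h0)
  have hind : ∀ j < r, x 0 ≤ (∏ k ∈ Finset.range j, ρ k) * x j := by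
    intro j
    induction j with
    | zero => simp
    | succ j ih =>
      intro hj
      refine (ih (by omega)).trans ?_
      rw [Finset.prod_range_succ, mul_assoc]
      exact mul_le_mul_of_nonneg_left (hstep j (by omega)).1
        (Finset.prod_nonneg fun k hk => hρ0 k (by have := Finset.mem_range.1 hk; omega))
  obtain ⟨r, rfl⟩ : ∃ r', r = r' + 1 := ⟨r - 1, by omega⟩
  refine (hind r (by omega)).trans ?_
  rw [Finset.prod_range_succ, mul_assoc]
  refine mul_le_mul_of_nonneg_left ?_
    (Finset.prod_nonneg fun k hk => hρ0 k (by have := Finset.mem_range.1 hk; omega))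
  exact (hstep r (by omega)).2

end Recursion

/-! ### Numerical estimates -/

section Numerics

/-- With `t = 3Rz/2`, Bernoulli's inequality gives `(1 + z) ^ (3R) ≥ (1 + t) ^ 2 ≥ 4t = 6Rz`. -/
theorem mul_le_rpow_div_six {R z : ℝ} (hR : 1 ≤ R) (hz : 0 ≤ z) :
    R * z ≤ (1 + z) ^ (3 * R) / 6 := by
  have h1 := one_add_mul_self_le_rpow_one_add (s := z) (by linarith) (p := 3 * R / 2)
    (by linarith)
  have h2 : (1 + z) ^ (3 * R) = ((1 + z) ^ (3 * R / 2)) ^ 2 := by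
    rw [← Real.rpow_natCast, ← Real.rpow_mul (by linarith)]
    congr 1
    push_cast
    ring
  have h3 : 0 ≤ 3 * R / 2 * z := by positivity
  rw [h2]
  nlinarith [sq_nonneg (3 * R / 2 * z - 1)]

/-- Each factor is at most `(g k / g (k+2)) ^ (3R) / 6`, where `g` counts the women in excess of a
layer. The ratios telescope to a product of two ratios `g i / g j`, each at most `N` because `n / N
≤ g j` and `g i ≤ n`. -/
theorem prod_le_rpow {R : ℝ} (hR : 1 ≤ R) {N n r : ℕ} (hNn : N ≤ n) {c : ℕ → ℕ}
    (hmono : Monotone c) (hc : c (2 * r + 1) < N) {v : ℕ → ℝ} (hv0 : ∀ k, 0 ≤ v k)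
    (hv : ∀ k, v k ≤ (c (2 * k + 1) : ℝ) - c (2 * k)) :
    ∏ k ∈ Finset.range r, (R * v k / ((n : ℝ) - c (2 * k + 3))) ≤
      (1 / 6) ^ r * (N : ℝ) ^ (6 * R) := by
  have hN : 1 ≤ N := by omega
  -- Truncated subtraction makes `g 0 = n - c 0`.
  set g : ℕ → ℝ := fun k => (n : ℝ) - c (2 * k - 1) with hg
  have hN0 : (0 : ℝ) < N := by exact_mod_cast hN
  have hn0 : (0 : ℝ) < n := by exact_mod_cast hN.trans hNn
  have hglow : ∀ k ≤ r + 1, (n : ℝ) / N ≤ g k := by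
    intro k hk
    have h1 : c (2 * k - 1) ≤ c (2 * r + 1) := hmono (by omega)
    have h2 : (c (2 * k - 1) : ℝ) + 1 ≤ N := by exact_mod_cast (by omega : c (2 * k - 1) + 1 ≤ N)
    rw [div_le_iff₀ hN0]
    have h3 : (N : ℝ) ≤ n := by exact_mod_cast hNn
    have h4 : (1 : ℝ) ≤ N := by exact_mod_cast hN
    have h5 : (n : ℝ) - N + 1 ≤ g k := by rw [hg]; linarith
    nlinarith [mul_nonneg (sub_nonneg.2 h3) (sub_nonneg.2 h4)]
  have hgpos : ∀ k ≤ r + 1, 0 < g k := fun k hk => (div_pos hn0 hN0).trans_le (hglow k hk)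
  have hgle : ∀ k, g k ≤ n := fun k => by simp [hg]
  have hfac : ∀ k ∈ Finset.range r, R * v k / ((n : ℝ) - c (2 * k + 3)) ≤
      1 / 6 * (g k / g (k + 2)) ^ (3 * R) := by
    intro k hk
    have hk := Finset.mem_range.1 hk
    have hu : (n : ℝ) - c (2 * k + 3) = g (k + 2) := by
      rw [hg]
      congr 3
    have hupos := hgpos (k + 2) (by omega)
    rw [hu, mul_div_assoc]
    refine (mul_le_rpow_div_six hR (div_nonneg (hv0 k) hupos.le)).trans ?_
    rw [div_eq_inv_mul, one_div]
    refine mul_le_mul_of_nonneg_left (Real.rpow_le_rpow ?_ ?_ (by linarith)) (by norm_num)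
    · have := div_nonneg (hv0 k) hupos.le
      linarith
    · rw [one_add_div hupos.ne']
      refine div_le_div_of_nonneg_right ?_ hupos.le
      have h1 : (c (2 * k - 1) : ℝ) ≤ c (2 * k) := by exact_mod_cast hmono (by omega)
      have h2 : (c (2 * k + 1) : ℝ) ≤ c (2 * k + 3) := by exact_mod_cast hmono (by omega)
      have h3 := hv k
      rw [← hu]
      simp only [hg]
      linarith
  have hprod : ∀ j ≤ r, ∏ k ∈ Finset.range j, (g k / g (k + 2)) =
      g 0 / g j * (g 1 / g (j + 1)) := by
    intro j
    induction j with
    | zero =>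
      intro _
      have h0 := (hgpos 0 (by omega)).ne'
      have h1 := (hgpos 1 (by omega)).ne'
      simp [h0, h1]
    | succ j ih =>
      intro hj
      rw [Finset.prod_range_succ, ih (by omega)]
      have h0 := (hgpos j (by omega)).ne'
      have h1 := (hgpos (j + 1) (by omega)).ne'
      have h2 := (hgpos (j + 2) (by omega)).ne'
      field_simp
  have hratio : ∀ i, ∀ j ≤ r + 1, g i / g j ≤ N := by
    intro i j hj
    rw [div_le_iff₀ (hgpos j hj)]
    have := hglow j hj
    rw [div_le_iff₀ hN0] at this
    linarith [hgle i]
  calc _ ≤ ∏ k ∈ Finset.range r, (1 / 6 * (g k / g (k + 2)) ^ (3 * R)) := by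
        refine Finset.prod_le_prod (fun k hk => ?_) hfac
        have hk := Finset.mem_range.1 hk
        have hu : (n : ℝ) - c (2 * k + 3) = g (k + 2) := by
          rw [hg]
          congr 3
        rw [hu]
        exact div_nonneg (mul_nonneg (by linarith) (hv0 k)) (hgpos (k + 2) (by omega)).le
    _ = (1 / 6) ^ r * (∏ k ∈ Finset.range r, (g k / g (k + 2))) ^ (3 * R) := by
        rw [Finset.prod_mul_distrib, Finset.prod_const, Finset.card_range,
          Real.finsetProd_rpow]
        intro k hk
        have hk := Finset.mem_range.1 hk
        exact (div_pos (hgpos k (by omega)) (hgpos (k + 2) (by omega))).le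
    _ ≤ (1 / 6) ^ r * ((N : ℝ) ^ 2) ^ (3 * R) := by
        refine mul_le_mul_of_nonneg_left (Real.rpow_le_rpow ?_ ?_ (by linarith)) (by positivity)
        · refine Finset.prod_nonneg fun k hk => ?_
          have hk := Finset.mem_range.1 hk
          exact (div_pos (hgpos k (by omega)) (hgpos (k + 2) (by omega))).le
        · rw [hprod r le_rfl, sq]
          exact mul_le_mul (hratio 0 r (by omega)) (hratio 1 (r + 1) le_rfl)
            (div_pos (hgpos 1 (by omega)) (hgpos (r + 1) le_rfl)).le hN0.le
    _ = _ := by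
        rw [← Real.rpow_natCast (N : ℝ) 2, ← Real.rpow_mul hN0.le]
        congr 2
        push_cast
        ring

theorem inv_log_one_add_ge {R : ℝ} (hR : 1 ≤ R) {a : ℝ} (ha : 0 ≤ a) :
    a * R ≤ a / Real.log (1 + 1 / R) := by
  have h0 : 0 < R := by linarith
  have h1 : 0 < 1 / R := by positivity
  have hlog : 0 < Real.log (1 + 1 / R) := Real.log_pos (by linarith)
  have h2 : Real.log (1 + 1 / R) ≤ 1 / R := by
    have := Real.log_le_sub_one_of_pos (show 0 < 1 + 1 / R by linarith)
    linarith
  rw [le_div_iff₀ hlog]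
  calc a * R * Real.log (1 + 1 / R) ≤ a * R * (1 / R) :=
        mul_le_mul_of_nonneg_left h2 (by positivity)
    _ = a := by field_simp

/-- From `2 ^ 11 ≤ 60 ^ 2` one has `log₂ N ≥ 5.5`, so the hypothesis yields `6.5 R ln N < r + 1.5`.
Now `ln 6 ≥ 7/4` and `R ln N ≥ 2` give `(6R + 4) ln N ≤ 10 R ln N ≤ r ln 6`. -/
theorem rpow_le_six_pow {R : ℝ} (hR : 1 ≤ R) {N r : ℕ} (hN : 60 ≤ N)
    (hr : 4 * Real.log N * (1 + Real.logb 2 N) / Real.log (1 + 1 / R) < 4 * r + 6) :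
    (N : ℝ) ^ (6 * R + 4) ≤ 6 ^ r := by
  have hN60 : (60 : ℝ) ≤ N := by exact_mod_cast hN
  have hN0 : (0 : ℝ) < N := by linarith
  have hlogb : 5.5 ≤ Real.logb 2 N := by
    rw [Real.le_logb_iff_rpow_le (by norm_num) hN0]
    have h1 : ((2 : ℝ) ^ (5.5 : ℝ)) ^ 2 ≤ (N : ℝ) ^ 2 := by
      rw [← Real.rpow_natCast, ← Real.rpow_mul (by norm_num),
        show (5.5 : ℝ) * (2 : ℕ) = (11 : ℕ) by norm_num, Real.rpow_natCast]
      nlinarith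
    exact (pow_le_pow_iff_left₀ (by positivity) hN0.le (by norm_num)).1 h1
  have hlog : 2 ≤ Real.log N := by
    rw [Real.le_log_iff_exp_le hN0]
    have h1 : Real.exp 2 = Real.exp 1 ^ 2 := by
      rw [← Real.exp_nat_mul]; norm_num
    rw [h1]
    nlinarith [Real.exp_one_lt_d9, Real.exp_pos 1]
  have hlog6 : 7 / 4 ≤ Real.log 6 := by
    rw [Real.le_log_iff_exp_le (by norm_num)]
    have h1 : Real.exp (7 / 4) ^ 4 ≤ 6 ^ 4 := by
      rw [← Real.exp_nat_mul, show ((4 : ℕ) : ℝ) * (7 / 4) = (7 : ℕ) * 1 by norm_num,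
        Real.exp_nat_mul]
      calc Real.exp 1 ^ 7 ≤ 2.7182818286 ^ 7 :=
            pow_le_pow_left₀ (Real.exp_pos 1).le Real.exp_one_lt_d9.le 7
        _ ≤ 6 ^ 4 := by norm_num
    exact (pow_le_pow_iff_left₀ (Real.exp_pos _).le (by norm_num) (by norm_num)).1 h1
  have h1 := inv_log_one_add_ge hR (a := 4 * Real.log N * (1 + Real.logb 2 N))
    (by positivity)
  have h2 : 4 * Real.log N * 6.5 * R ≤ 4 * Real.log N * (1 + Real.logb 2 N) * R := by
    gcongr
    linarith
  rw [← Real.log_le_log_iff (by positivity) (by positivity), Real.log_rpow hN0, Real.log_pow]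
  have h3 : 6.5 * (R * Real.log N) < r + 1.5 := by nlinarith
  have h4 : (2 : ℝ) ≤ R * Real.log N := by nlinarith
  have h5 : (r : ℝ) * (7 / 4) ≤ r * Real.log 6 :=
    mul_le_mul_of_nonneg_left hlog6 (Nat.cast_nonneg r)
  nlinarith

/-- As `R ≥ 1`, the logarithm in the denominator is at most `ln 2`, whence `k (k+1) ≤ r + 1`
whenever `2 ^ k ≤ N`. This settles each dyadic range of `N`; the last one, `k = 5`, gives `2r + 1 ≥
59`, which fixes the threshold `60`. -/
theorem le_two_mul_of_lt_sixty {R : ℝ} (hR : 1 ≤ R) {N r : ℕ} (hN2 : 2 ≤ N) (hN : N < 60)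
    (hr : 4 * Real.log N * (1 + Real.logb 2 N) / Real.log (1 + 1 / R) < 4 * r + 6) :
    N ≤ 2 * r + 1 := by
  have hN0 : (0 : ℝ) < N := by positivity
  have h0 : 0 < R := by linarith
  have h1 : 0 < 1 / R := by positivity
  have hlog : 0 < Real.log (1 + 1 / R) := Real.log_pos (by linarith)
  have hlog2 : Real.log (1 + 1 / R) ≤ Real.log 2 := by
    refine Real.log_le_log (by linarith) ?_
    have : 1 / R ≤ 1 := by rw [div_le_one h0]; exact hR
    linarith
  have hl2 : 0 < Real.log 2 := Real.log_pos (by norm_num)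
  have hlN : 0 < Real.log N := Real.log_pos (by exact_mod_cast hN2)
  have hlb : Real.logb 2 N = Real.log N / Real.log 2 := rfl
  have hlbpos : 0 < Real.logb 2 N := by rw [hlb]; positivity
  have hK : 4 * Real.logb 2 N * (1 + Real.logb 2 N) < 4 * r + 6 := by
    refine lt_of_le_of_lt ?_ hr
    calc 4 * Real.logb 2 N * (1 + Real.logb 2 N)
        = 4 * Real.log N * (1 + Real.logb 2 N) / Real.log 2 := by rw [hlb]; ring
      _ ≤ _ := div_le_div_of_nonneg_left (by positivity) hlog hlog2
  have hdy : ∀ k : ℕ, 2 ^ k ≤ N → k * (k + 1) ≤ r + 1 := by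
    intro k hk
    have hkl : (k : ℝ) ≤ Real.logb 2 N := by
      rw [Real.le_logb_iff_rpow_le (by norm_num) hN0, Real.rpow_natCast]
      exact_mod_cast hk
    have h2 : (k : ℝ) * (k + 1) < r + 2 := by
      have : (k : ℝ) * (1 + k) ≤ Real.logb 2 N * (1 + Real.logb 2 N) := by gcongr
      nlinarith
    have h3 : k * (k + 1) < r + 2 := by exact_mod_cast h2
    omega
  rcases lt_or_ge N 4 with h | h
  · have := hdy 1 (by omega); omega
  rcases lt_or_ge N 8 with h | h
  · have := hdy 2 (by omega); omega
  rcases lt_or_ge N 16 with h | h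
  · have := hdy 3 (by omega); omega
  rcases lt_or_ge N 32 with h | h
  · have := hdy 4 (by omega); omega
  · have := hdy 5 (by omega); omega

end Numerics

/-! ### Randomness of the men, for fixed lists of the women -/

section MenSide

open scoped ENNReal

variable {M W : Type*} [Fintype M] [Fintype W] [DecidableEq M] [DecidableEq W]
  [Nonempty M] [Nonempty W] {DM : M → Popularity W}
  {LW : W → PrefList (Finset.univ : Finset M)} {w : W}

/-- With fixed lists of the women, a long chain of sets of men on which the women agree separates
the stable husbands of `w` with high probability. -/
theorem listsLaw_stableHusband_le {N r : ℕ} (hN2 : 2 ≤ N) (hNW : N ≤ Fintype.card W)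
    (hr : 4 * Real.log N * (1 + Real.logb 2 N) / Real.log (1 + 1 / maxRatio DM) < 4 * r + 6)
    {C : ℕ → Finset M} (hmono : Monotone C) (hcard : (C (2 * r + 1)).card < N)
    (hdom : ∀ i ≤ 2 * r + 1, Dominates LW (C i) (C (i + 1))) {m₀ : M} (hm₀ : m₀ ∈ C 1) :
    listsLaw DM {L | IsStableHusband (L, LW) w m₀ ∧
      ∃ m₁ ∉ C (2 * r + 2), IsStableHusband (L, LW) w m₁} ≤ ENNReal.ofReal (1 / (N : ℝ) ^ 3) := by
  have hR : 1 ≤ maxRatio DM := one_le_maxRatio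
  have hA : (C (2 * r + 1)).card < Fintype.card W := hcard.trans_le hNW
  have hto : ∀ i, 1 ≤ i → i ≤ 2 * r + 1 → ∀ L, (IsStableHusband (L, LW) w m₀ ∧
      ∃ m₁ ∉ C (2 * r + 2), IsStableHusband (L, LW) w m₁) →
      ∃ k, daTime M W ≤ k ∧ k < daTime M W + daTime M W ∧
        L ∈ crossEvent LW w (C (2 * r + 1)) (C i) k := by
    rintro i hi hi' L ⟨h0, m₁, hm₁, h1⟩
    exact exists_takesOver (P := (L, LW)) h0 h1 hA
      (fun m hm => hdom (2 * r + 1) le_rfl w m hm m₁ hm₁) (hmono hi') (hmono hi hm₀)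
  rcases lt_or_ge N 60 with hN | hN
  · have hNr := le_two_mul_of_lt_sixty hR hN2 hN hr
    -- The layers are nonempty with fewer than `N ≤ 2r + 1` men, so two consecutive ones coincide.
    -- Such a layer is preferred by all women to its complement, and no takeover from it is
    -- possible.
    have hex : ∃ i, 1 ≤ i ∧ i ≤ 2 * r ∧ C i = C (i + 1) := by
      by_contra hne
      push Not at hne
      have hlt : ∀ i ≤ 2 * r, i + 1 ≤ (C (i + 1)).card := by
        intro i
        induction i with
        | zero =>
          intro _
          exact Finset.card_pos.2 ⟨m₀, hm₀⟩
        | succ i ih =>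
          intro hi
          have h1 := ih (by omega)
          have h2 : C (i + 1) ⊂ C (i + 1 + 1) :=
            (hmono (by omega : i + 1 ≤ i + 1 + 1)).ssubset_of_ne (hne (i + 1) (by omega) hi)
          have := Finset.card_lt_card h2
          omega
      have := hlt (2 * r) le_rfl
      omega
    obtain ⟨i, hi, hi', hCi⟩ := hex
    have hempty : {L | IsStableHusband (L, LW) w m₀ ∧
        ∃ m₁ ∉ C (2 * r + 2), IsStableHusband (L, LW) w m₁} = ∅ := by
      refine Set.eq_empty_of_forall_notMem fun L hL => ?_
      obtain ⟨k, -, -, p, -, hp, hacc, b, hb, hb'⟩ := hto i hi (by omega) L hL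
      refine (hdom i (by omega) p.2 b hb p.1 ?_).asymm (hacc.2 b hb')
      rwa [← hCi]
    rw [hempty]
    simp
  · have hr0 : 0 < r := by
      rcases Nat.eq_zero_or_pos r with h | h
      · exfalso
        have := rpow_le_six_pow hR hN hr
        subst h
        rw [pow_zero] at this
        have h1 : (1 : ℝ) < (N : ℝ) ^ (6 * maxRatio DM + 4) :=
          Real.one_lt_rpow (by exact_mod_cast (by omega : 1 < N)) (by linarith)
        linarith
      · exact h
    have hle : listsLaw DM {L | IsStableHusband (L, LW) w m₀ ∧
        ∃ m₁ ∉ C (2 * r + 2), IsStableHusband (L, LW) w m₁} ≤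
        expectedCross DM LW w (C (2 * r + 1)) (C 1) := by
      rw [expectedCross]
      refine le_trans (measure_mono ?_) (measure_biUnion_finset_le _ _)
      intro L hL
      obtain ⟨k, hk, hk', h⟩ := hto 1 le_rfl (by omega) L hL
      exact Set.mem_iUnion₂.2 ⟨k, Finset.mem_Ico.2 ⟨hk, hk'⟩, h⟩
    refine hle.trans ?_
    rw [← ENNReal.ofReal_toReal expectedCross_ne_top]
    refine ENNReal.ofReal_le_ofReal ?_
    refine (expectedCross_le_prod hmono hr0 hA fun i hi => hdom i (by omega)).trans ?_
    have hNpos : (0 : ℝ) < N := by positivity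
    have hprod := prod_le_rpow hR hNW (c := fun i => (C i).card)
      (fun i j hij => Finset.card_le_card (hmono hij)) hcard
      (v := fun k => ((C (2 * k + 1) \ C (2 * k)).card : ℝ)) (fun k => Nat.cast_nonneg _)
      (fun k => by
        have hsub : C (2 * k) ⊆ C (2 * k + 1) := hmono (by omega)
        rw [Finset.card_sdiff_of_subset hsub, Nat.cast_sub (Finset.card_le_card hsub)])
    refine (mul_le_mul hprod (Nat.cast_le.2 hcard.le) (Nat.cast_nonneg _) (by positivity)).trans ?_
    -- The exponent `6R + 4` consists of `6R` from the product, `1` from the size of the last layer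
    -- and `3` from the target `1 / N ^ 3`.
    have h6 := rpow_le_six_pow hR hN hr
    rw [Real.rpow_add hNpos] at h6
    have h4 : (N : ℝ) ^ (4 : ℝ) = (N : ℝ) ^ 4 := by exact_mod_cast Real.rpow_natCast (N : ℝ) 4
    rw [h4] at h6
    rw [le_div_iff₀ (by positivity), one_div, inv_pow]
    have h6pos : (0 : ℝ) < 6 ^ r := by positivity
    calc ((6 : ℝ) ^ r)⁻¹ * (N : ℝ) ^ (6 * maxRatio DM) * N * (N : ℝ) ^ 3
        = ((6 : ℝ) ^ r)⁻¹ * ((N : ℝ) ^ (6 * maxRatio DM) * (N : ℝ) ^ 4) := by ring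
      _ ≤ ((6 : ℝ) ^ r)⁻¹ * 6 ^ r := mul_le_mul_of_nonneg_left h6 (by positivity)
      _ = 1 := inv_mul_cancel₀ h6pos.ne'

end MenSide

/-! ### Independence of one woman's list from the others -/

section Independence

open scoped ENNReal

variable {ι α : Type*} [Fintype ι] [DecidableEq ι] [Fintype α] [DecidableEq α]

theorem lintegral_pi_eq_lintegral_update {Ω : ι → Type*} [∀ i, MeasurableSpace (Ω i)]
    (μ : ∀ i, Measure (Ω i)) [∀ i, IsProbabilityMeasure (μ i)] (i : ι) {f : (∀ i, Ω i) → ℝ≥0∞}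
    (hf : Measurable f) (hg : Measurable fun x => ∫⁻ y, f (Function.update x i y) ∂μ i) :
    ∫⁻ x, f x ∂Measure.pi μ = ∫⁻ x, ∫⁻ y, f (Function.update x i y) ∂μ i ∂Measure.pi μ := by
  have h := lmarginal_eq_of_subset (μ := μ) (Finset.subset_univ {i}) hf hg (by
    rw [lmarginal_singleton, lmarginal_singleton]
    funext x
    simp)
  rw [lmarginal_univ, lmarginal_univ] at h
  obtain ⟨x⟩ : Nonempty (∀ i, Ω i) :=
    ⟨fun i => (nonempty_of_isProbabilityMeasure (μ i)).some⟩
  exact congrFun h x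

/-- The list of `x` is independent of every event that does not depend on it. -/
theorem listsLaw_inter_of_update (D : ι → Popularity α) (x : ι)
    (B : Set (PrefList (Finset.univ : Finset α))) (G : Set (ι → PrefList (Finset.univ : Finset α)))
    (hG : ∀ L l, Function.update L x l ∈ G ↔ L ∈ G) :
    listsLaw D {L | L x ∈ B ∧ L ∈ G} = ((D x).listLaw Finset.univ).toOuterMeasure B *
      listsLaw D G := by
  classical
  rw [← lintegral_indicator_one MeasurableSet.of_discrete,
    ← lintegral_indicator_one (s := G) MeasurableSet.of_discrete]
  unfold listsLaw
  rw [lintegral_pi_eq_lintegral_update _ x Measurable.of_discrete Measurable.of_discrete,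
    ← lintegral_const_mul _ Measurable.of_discrete]
  refine lintegral_congr fun L => ?_
  by_cases hL : L ∈ G
  · have h1 : ∀ l, ({L : ι → PrefList (Finset.univ : Finset α) | L x ∈ B ∧ L ∈ G}.indicator
        (1 : (ι → PrefList (Finset.univ : Finset α)) → ℝ≥0∞) (Function.update L x l)) = B.indicator 1 l := by
      intro l
      simp only [Set.indicator, Set.mem_ofPred_eq, Function.update_self, hG, hL, and_true,
        Pi.one_apply]
    simp_rw [h1]
    rw [lintegral_indicator_one MeasurableSet.of_discrete, Set.indicator_of_mem hL, Pi.one_apply,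
      mul_one, PMF.toMeasure_apply_eq_toOuterMeasure_apply _ MeasurableSet.of_discrete]
  · have h1 : ∀ l, ({L : ι → PrefList (Finset.univ : Finset α) | L x ∈ B ∧ L ∈ G}.indicator
        (1 : (ι → PrefList (Finset.univ : Finset α)) → ℝ≥0∞) (Function.update L x l)) = 0 := by
      intro l
      simp only [Set.indicator, Set.mem_ofPred_eq, hG, hL, and_false, if_false]
    simp_rw [h1]
    rw [Set.indicator_of_notMem hL]
    simp

theorem listsLaw_eval (D : ι → Popularity α) (x : ι)
    (B : Set (PrefList (Finset.univ : Finset α))) :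
    listsLaw D {L | L x ∈ B} = ((D x).listLaw Finset.univ).toOuterMeasure B := by
  have := listsLaw_inter_of_update D x B Set.univ (by simp)
  simpa using this

theorem listsLaw_eval_inter_eval (D : ι → Popularity α) {x y : ι} (hxy : x ≠ y)
    (B C : Set (PrefList (Finset.univ : Finset α))) :
    listsLaw D {L | L x ∈ B ∧ L y ∈ C} = ((D x).listLaw Finset.univ).toOuterMeasure B *
      ((D y).listLaw Finset.univ).toOuterMeasure C := by
  rw [← listsLaw_eval D y C]
  refine listsLaw_inter_of_update D x B {L | L y ∈ C} fun L l => ?_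
  simp [Function.update_of_ne hxy.symm]

end Independence

/-! ### Sets of the largest elements -/

section Top

variable {α : Type*} [Fintype α] [DecidableEq α]

/-- `T` consists of elements with the largest values of `f`. -/
def IsTopSet (f : α → ℝ) (T : Finset α) : Prop := ∀ a ∈ T, ∀ b ∉ T, f b ≤ f a

theorem exists_isTopSet (f : α → ℝ) {n : ℕ} (hn : n ≤ Fintype.card α) :
    ∃ T : Finset α, T.card = n ∧ IsTopSet f T := by
  induction n with
  | zero => exact ⟨∅, rfl, by simp [IsTopSet]⟩
  | succ n ih =>
    obtain ⟨T, hT, htop⟩ := ih (by omega)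
    have hne : (Tᶜ).Nonempty := by
      rw [← Finset.card_pos, Finset.card_compl]
      omega
    obtain ⟨b, hb, hmax⟩ := Finset.exists_max_image Tᶜ f hne
    have hbT := Finset.mem_compl.1 hb
    refine ⟨insert b T, by rw [Finset.card_insert_of_notMem hbT, hT], fun a ha c hc => ?_⟩
    rw [Finset.mem_insert, not_or] at hc
    rcases Finset.mem_insert.1 ha with rfl | ha
    · exact hmax c (Finset.mem_compl.2 hc.2)
    · exact htop a ha c hc.2

/-- Exchange argument: `T' \ T` is no larger than `T \ T'`, and its values do not exceed those on `T
\ T'`. -/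
theorem IsTopSet.sum_compl_le {f : α → ℝ} (hf : ∀ a, 0 ≤ f a) {T T' : Finset α} (hT : IsTopSet f T)
    (hcard : T'.card ≤ T.card) : ∑ a ∈ Tᶜ, f a ≤ ∑ a ∈ T'ᶜ, f a := by
  have hsd : ∑ a ∈ T' \ T, f a ≤ ∑ a ∈ T \ T', f a := by
    have hc : (T' \ T).card ≤ (T \ T').card := by
      have h1 := Finset.card_sdiff_add_card_inter T' T
      have h2 := Finset.card_sdiff_add_card_inter T T'
      rw [Finset.inter_comm] at h2
      omega
    rcases (T' \ T).eq_empty_or_nonempty with h | h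
    · rw [h, Finset.sum_empty]
      exact Finset.sum_nonneg fun a _ => hf a
    · obtain ⟨b, hb, hmax⟩ := Finset.exists_max_image (T' \ T) f h
      calc ∑ a ∈ T' \ T, f a ≤ (T' \ T).card • f b := Finset.sum_le_card_nsmul _ _ _ hmax
        _ ≤ (T \ T').card • f b := nsmul_le_nsmul_left (hf b) hc
        _ ≤ ∑ a ∈ T \ T', f a := Finset.card_nsmul_le_sum _ _ _ fun a ha =>
            hT a (Finset.mem_sdiff.1 ha).1 b (Finset.mem_sdiff.1 hb).2
  have h1 := Finset.sum_add_sum_compl T f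
  have h2 := Finset.sum_add_sum_compl T' f
  have h3 := Finset.sum_inter_add_sum_sdiff T T' f
  have h4 := Finset.sum_inter_add_sum_sdiff T' T f
  rw [Finset.inter_comm] at h4
  linarith

end Top

/-! ### Randomness of the women -/

section WomenSide

open scoped ENNReal

variable {M W : Type*} [Fintype M] [Fintype W] [DecidableEq M] [DecidableEq W]
  [Nonempty M] [Nonempty W] {DW : W → Popularity M}

theorem div_le_maxCrossRatio (x y : W) (a b : M) :
    DW x a * DW y b ≤ maxCrossRatio DW * DW y a * DW x b := by
  have h : DW x a / DW x b * (DW y b / DW y a) ≤ maxCrossRatio DW :=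
    Finset.le_sup' (fun t : (W × W) × (M × M) =>
      DW t.1.1 t.2.1 / DW t.1.1 t.2.2 * (DW t.1.2 t.2.2 / DW t.1.2 t.2.1))
      (Finset.mem_univ ((x, y), (a, b)))
  rw [div_mul_div_comm, div_le_iff₀ (mul_pos ((DW x).pos b) ((DW y).pos a))] at h
  linarith

theorem one_le_maxCrossRatio : 1 ≤ maxCrossRatio DW := by
  obtain ⟨m⟩ := ‹Nonempty M›
  obtain ⟨x⟩ := ‹Nonempty W›
  have := div_le_maxCrossRatio (DW := DW) x x m m
  have h0 := mul_pos ((DW x).pos m) ((DW x).pos m)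
  by_contra h
  nlinarith

/-- The list `l` inverts two men of very different popularity, the first being in `T` and of
popularity at least `c`. -/
def HasInversion (D : Popularity M) (β c : ℝ) (T : Finset M)
    (l : PrefList (Finset.univ : Finset M)) : Prop :=
  ∃ m ∈ T, c ≤ D m ∧ ∃ m', β ^ 2 * D m' ≤ D m ∧ ¬ l.Before m m'

/-- Union bound over inverted pairs, a pair costing at most `Q` times its popularity ratio for `w`.
Men of `T` contribute few ratios, each at most `β⁻²`; the men outside `T` have total popularity `τ`,
which is tiny compared with the threshold `c`. -/
theorem listLaw_hasInversion_le {N : ℕ} (hN : 2 ≤ N) {T : Finset M} (hT : T.card ≤ N) (w x : W) :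
    ((DW x).listLaw Finset.univ).toOuterMeasure {l | HasInversion (DW w)
      ((N : ℝ) ^ 5 * maxCrossRatio DW)
      ((N : ℝ) ^ 6 * maxCrossRatio DW * ∑ m ∈ Tᶜ, DW w m) T l} ≤
      ENNReal.ofReal (2 / (N : ℝ) ^ 5) := by
  classical
  set Q := maxCrossRatio DW with hQ
  have hQ1 : 1 ≤ Q := one_le_maxCrossRatio
  have hN2 : (2 : ℝ) ≤ N := by exact_mod_cast hN
  have hN0 : (0 : ℝ) < N := by linarith
  set β : ℝ := (N : ℝ) ^ 5 * Q with hβ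
  have hβ1 : 1 < β := by
    have : (1 : ℝ) < (N : ℝ) ^ 5 := one_lt_pow₀ (by linarith) (by norm_num)
    nlinarith
  have hβ2 : 1 < β ^ 2 := one_lt_pow₀ hβ1 (by norm_num)
  set τ := ∑ m ∈ Tᶜ, DW w m with hτ
  have hτ0 : 0 ≤ τ := Finset.sum_nonneg fun m _ => ((DW w).pos m).le
  set c := (N : ℝ) ^ 6 * Q * τ with hc
  set T₁ : Finset M := T.filter fun m => c ≤ DW w m with hT₁
  set F : M → Finset M := fun m => Finset.univ.filter fun m' => β ^ 2 * DW w m' ≤ DW w m with hF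
  have hsub : {l : PrefList (Finset.univ : Finset M) | HasInversion (DW w) β c T l} ⊆
      ⋃ m ∈ T₁, ⋃ m' ∈ F m, {l | l.Before m' m} := by
    rintro l ⟨m, hm, hcm, m', hm', hb⟩
    refine Set.mem_iUnion₂.2 ⟨m, Finset.mem_filter.2 ⟨hm, hcm⟩, Set.mem_iUnion₂.2
      ⟨m', Finset.mem_filter.2 ⟨Finset.mem_univ _, hm'⟩, l.before_of_not_before hb ?_⟩⟩
    rintro rfl
    have := (DW w).pos m
    nlinarith
  have hne : ∀ m, ∀ m' ∈ F m, m' ≠ m := by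
    rintro m m' hm' rfl
    have h1 := (Finset.mem_filter.1 hm').2
    have := (DW w).pos m'
    nlinarith
  have hrat : ∀ m m', DW x m' / DW x m ≤ Q * (DW w m' / DW w m) := by
    intro m m'
    have := div_le_maxCrossRatio (DW := DW) x w m' m
    rw [div_le_iff₀ ((DW x).pos m)]
    have hpos := (DW w).pos m
    calc DW x m' = DW x m' * DW w m / DW w m := by field_simp
      _ ≤ Q * DW w m' * DW x m / DW w m := div_le_div_of_nonneg_right this hpos.le
      _ = _ := by ring
  have hFsum : ∀ m ∈ T₁, ∑ m' ∈ F m, DW w m' / DW w m ≤ N / β ^ 2 + 1 / ((N : ℝ) ^ 6 * Q) := by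
    intro m hm
    have hcm := (Finset.mem_filter.1 hm).2
    have hpos := (DW w).pos m
    have hβ2 : 0 < β ^ 2 := by positivity
    have h1 : ∑ m' ∈ F m ∩ T, DW w m' ≤ N * (DW w m / β ^ 2) := by
      calc ∑ m' ∈ F m ∩ T, DW w m' ≤ (F m ∩ T).card • (DW w m / β ^ 2) := by
            refine Finset.sum_le_card_nsmul _ _ _ fun m' hm' => ?_
            rw [le_div_iff₀ hβ2, mul_comm]
            exact (Finset.mem_filter.1 (Finset.mem_inter.1 hm').1).2
        _ ≤ N * (DW w m / β ^ 2) := by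
            rw [nsmul_eq_mul]
            refine mul_le_mul_of_nonneg_right ?_ (by positivity)
            exact_mod_cast (Finset.card_le_card Finset.inter_subset_right).trans hT
    have h2 : ∑ m' ∈ F m \ T, DW w m' ≤ τ := by
      refine Finset.sum_le_sum_of_subset_of_nonneg (fun m' hm' => ?_)
        fun m' _ _ => ((DW w).pos m').le
      exact Finset.mem_compl.2 (Finset.mem_sdiff.1 hm').2
    rw [← Finset.sum_div, ← Finset.sum_inter_add_sum_sdiff (F m) T, add_div]
    refine add_le_add ?_ ?_
    · rw [div_le_iff₀ hpos]
      calc _ ≤ _ := h1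
        _ = _ := by ring
    · rw [div_le_div_iff₀ hpos (by positivity)]
      calc _ ≤ τ * ((N : ℝ) ^ 6 * Q) := mul_le_mul_of_nonneg_right h2 (by positivity)
        _ = c := by rw [hc]; ring
        _ ≤ _ := by rw [one_mul]; exact hcm
  calc _ ≤ ∑ m ∈ T₁, ∑ m' ∈ F m, ENNReal.ofReal (Q * (DW w m' / DW w m)) := by
        refine (measure_mono hsub).trans ((measure_biUnion_finset_le _ _).trans
          (Finset.sum_le_sum fun m _ => (measure_biUnion_finset_le _ _).trans
          (Finset.sum_le_sum fun m' hm' => ?_)))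
        exact ((DW x).listLaw_before_le (Finset.mem_univ _) (Finset.mem_univ _)
          (hne m m' hm')).trans (ENNReal.ofReal_le_ofReal (hrat m m'))
    _ = ENNReal.ofReal (∑ m ∈ T₁, ∑ m' ∈ F m, Q * (DW w m' / DW w m)) := by
        have hnn : ∀ m m', 0 ≤ Q * (DW w m' / DW w m) := fun m m' =>
          mul_nonneg (by linarith) (div_nonneg ((DW w).pos m').le ((DW w).pos m).le)
        rw [ENNReal.ofReal_sum_of_nonneg fun m _ => Finset.sum_nonneg fun m' _ => hnn m m']
        exact Finset.sum_congr rfl fun m _ =>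
          (ENNReal.ofReal_sum_of_nonneg fun m' _ => hnn m m').symm
    _ ≤ _ := by
        refine ENNReal.ofReal_le_ofReal ?_
        calc ∑ m ∈ T₁, ∑ m' ∈ F m, Q * (DW w m' / DW w m)
            ≤ ∑ _m ∈ T₁, Q * (N / β ^ 2 + 1 / ((N : ℝ) ^ 6 * Q)) := by
              refine Finset.sum_le_sum fun m hm => ?_
              rw [← Finset.mul_sum]
              exact mul_le_mul_of_nonneg_left (hFsum m hm) (by linarith)
          _ = T₁.card * (Q * (N / β ^ 2 + 1 / ((N : ℝ) ^ 6 * Q))) := by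
              rw [Finset.sum_const, nsmul_eq_mul]
          _ ≤ N * (Q * (N / β ^ 2 + 1 / ((N : ℝ) ^ 6 * Q))) := by
              refine mul_le_mul_of_nonneg_right ?_ (by positivity)
              exact_mod_cast (Finset.card_le_card (Finset.filter_subset _ _)).trans hT
          _ = 1 / ((N : ℝ) ^ 8 * Q) + 1 / (N : ℝ) ^ 5 := by
              rw [hβ]
              field_simp
          _ ≤ 1 / (N : ℝ) ^ 5 + 1 / (N : ℝ) ^ 5 := by
              have h1 : (N : ℝ) ^ 5 ≤ (N : ℝ) ^ 8 * Q := by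
                have h2 : (N : ℝ) ^ 5 ≤ (N : ℝ) ^ 8 :=
                  pow_le_pow_right₀ (by linarith) (by norm_num)
                nlinarith [pow_pos hN0 8]
              have := one_div_le_one_div_of_le (by positivity) h1
              linarith
          _ = 2 / (N : ℝ) ^ 5 := by ring

/-- Men with a negligible share of the popularity outside of the top are unlikely to be ranked high
by `w` and by another woman. -/
theorem listsLaw_two_high_ranks_le {N : ℕ} (hN : 2 ≤ N) {T : Finset M} (hT : T.card = N) (w : W)
    (htop : IsTopSet (DW w) T) (hW : T ≠ Finset.univ → Fintype.card W ≤ N) :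
    listsLaw DW {L | ∃ x ≠ w, ∃ m,
      DW w m ≤ (∑ m ∈ Tᶜ, DW w m) / ((N : ℝ) ^ 7 * maxCrossRatio DW) ∧
      (L w).1.idxOf m < N ∧ (L x).1.idxOf m < N} ≤ ENNReal.ofReal (2 / (N : ℝ) ^ 4) := by
  classical
  set Q := maxCrossRatio DW with hQ
  have hQ1 : 1 ≤ Q := one_le_maxCrossRatio
  have hN2 : (2 : ℝ) ≤ N := by exact_mod_cast hN
  have hN0 : (0 : ℝ) < N := by linarith
  set τ := ∑ m ∈ Tᶜ, DW w m with hτ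
  set δ := τ / ((N : ℝ) ^ 7 * Q) with hδ
  by_cases huniv : T = Finset.univ
  · have hδ0 : δ = 0 := by simp [hδ, hτ, huniv]
    refine le_trans (le_of_eq ?_) zero_le
    convert measure_empty (μ := listsLaw DW)
    ext L
    simp only [Set.mem_ofPred_eq, Set.mem_empty_iff_false, iff_false]
    rintro ⟨x, -, m, hm, -⟩
    have := (DW w).pos m
    linarith
  have hWN := hW huniv
  have hτ0 : 0 < τ := by
    refine Finset.sum_pos (fun m _ => (DW w).pos m) ?_
    rw [Finset.nonempty_iff_ne_empty]
    intro h
    exact huniv (Finset.compl_eq_empty_iff _ |>.1 h)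
  have hδ0 : 0 ≤ δ := by positivity
  set F : Finset M := Finset.univ.filter fun m => DW w m ≤ δ with hF
  -- While the first `N` places are drawn, popularity at least `τ` remains, as removing the top set
  -- `T` is the worst case.
  have hrem : ∀ T' ⊆ (Finset.univ : Finset M), T'.card < N →
      τ ≤ ∑ b ∈ Finset.univ \ T', DW w b := by
    intro T' _ hT'
    rw [← Finset.compl_eq_univ_sdiff]
    exact htop.sum_compl_le (fun a => ((DW w).pos a).le) (by omega)
  have hPw : ∀ m, ((DW w).listLaw Finset.univ).toOuterMeasure {l | l.1.idxOf m < N} ≤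
      N * ENNReal.ofReal (DW w m / τ) := by
    intro m
    refine (DW w).listLaw_idxOf_lt_le (Finset.mem_univ m) N fun T' hT' hcard => ?_
    have h1 := hrem T' hT' hcard
    rw [div_mul_eq_mul_div, le_div_iff₀ hτ0]
    exact mul_le_mul_of_nonneg_left h1 ((DW w).pos m).le
  have hPx : ∀ x m, ((DW x).listLaw Finset.univ).toOuterMeasure {l | l.1.idxOf m < N} ≤
      N * ENNReal.ofReal (Q * DW w m / τ) := by
    intro x m
    refine (DW x).listLaw_idxOf_lt_le (Finset.mem_univ m) N fun T' hT' hcard => ?_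
    have h1 := hrem T' hT' hcard
    rw [div_mul_eq_mul_div, le_div_iff₀ hτ0]
    calc DW x m * τ ≤ DW x m * ∑ b ∈ Finset.univ \ T', DW w b :=
          mul_le_mul_of_nonneg_left h1 ((DW x).pos m).le
      _ ≤ _ := by
          rw [Finset.mul_sum, Finset.mul_sum]
          exact Finset.sum_le_sum fun b _ => div_le_maxCrossRatio x w m b
  have hFsum : ∑ m ∈ F, DW w m ≤ 2 * τ := by
    have h1 : ∑ m ∈ F ∩ T, DW w m ≤ N * δ := by
      calc ∑ m ∈ F ∩ T, DW w m ≤ (F ∩ T).card • δ :=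
            Finset.sum_le_card_nsmul _ _ _ fun m hm =>
              (Finset.mem_filter.1 (Finset.mem_inter.1 hm).1).2
        _ ≤ N * δ := by
            rw [nsmul_eq_mul]
            refine mul_le_mul_of_nonneg_right ?_ hδ0
            exact_mod_cast (Finset.card_le_card Finset.inter_subset_right).trans hT.le
    have h2 : ∑ m ∈ F \ T, DW w m ≤ τ :=
      Finset.sum_le_sum_of_subset_of_nonneg
        (fun m' hm' => Finset.mem_compl.2 (Finset.mem_sdiff.1 hm').2)
        fun m' _ _ => ((DW w).pos m').le
    have h3 : N * δ ≤ τ := by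
      rw [hδ, ← mul_div_assoc, div_le_iff₀ (by positivity), mul_comm]
      refine mul_le_mul_of_nonneg_left ?_ hτ0.le
      have h4 : (N : ℝ) ^ 1 ≤ (N : ℝ) ^ 7 := pow_le_pow_right₀ (by linarith) (by norm_num)
      nlinarith [pow_pos hN0 7]
    rw [← Finset.sum_inter_add_sum_sdiff F T]
    linarith
  have hsub : {L : W → PrefList (Finset.univ : Finset M) | ∃ x ≠ w, ∃ m, DW w m ≤ δ ∧
      (L w).1.idxOf m < N ∧ (L x).1.idxOf m < N} ⊆
      ⋃ x ∈ Finset.univ.erase w, ⋃ m ∈ F,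
        {L | L w ∈ {l | l.1.idxOf m < N} ∧ L x ∈ {l | l.1.idxOf m < N}} := by
    rintro L ⟨x, hx, m, hm, h1, h2⟩
    exact Set.mem_iUnion₂.2 ⟨x, Finset.mem_erase.2 ⟨hx, Finset.mem_univ _⟩, Set.mem_iUnion₂.2
      ⟨m, Finset.mem_filter.2 ⟨Finset.mem_univ _, hm⟩, h1, h2⟩⟩
  have hnn : ∀ m, 0 ≤ N * (DW w m / τ) * (N * (Q * DW w m / τ)) := fun m => by
    have := ((DW w).pos m).le
    positivity
  calc _ ≤ ∑ x ∈ Finset.univ.erase w, ∑ m ∈ F,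
          ENNReal.ofReal (N * (DW w m / τ) * (N * (Q * DW w m / τ))) := by
        refine (measure_mono hsub).trans ((measure_biUnion_finset_le _ _).trans
          (Finset.sum_le_sum fun x hx => (measure_biUnion_finset_le _ _).trans
          (Finset.sum_le_sum fun m _ => ?_)))
        rw [listsLaw_eval_inter_eval DW (Finset.ne_of_mem_erase hx).symm]
        have := ((DW w).pos m).le
        refine (mul_le_mul' (hPw m) (hPx x m)).trans (le_of_eq ?_)
        rw [ENNReal.ofReal_mul (by positivity), ENNReal.ofReal_mul (by positivity),
          ENNReal.ofReal_mul (by positivity), ENNReal.ofReal_natCast]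
    _ ≤ N * ∑ m ∈ F, ENNReal.ofReal (N * (DW w m / τ) * (N * (Q * DW w m / τ))) := by
        rw [Finset.sum_const, nsmul_eq_mul]
        refine mul_le_mul_left ?_ _
        exact_mod_cast (Finset.card_le_univ _).trans hWN
    _ = ENNReal.ofReal (N * ∑ m ∈ F, N * (DW w m / τ) * (N * (Q * DW w m / τ))) := by
        rw [ENNReal.ofReal_mul hN0.le, ENNReal.ofReal_natCast,
          ENNReal.ofReal_sum_of_nonneg fun m _ => hnn m]
    _ ≤ _ := by
        refine ENNReal.ofReal_le_ofReal ?_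
        -- The product of two rank probabilities is quadratic in the popularity: one factor is at
        -- most `δ`, the other sums to at most `2 * τ`.
        calc (N : ℝ) * ∑ m ∈ F, N * (DW w m / τ) * (N * (Q * DW w m / τ))
            ≤ N * ∑ m ∈ F, ((N : ℝ) ^ 2 * Q * δ / τ ^ 2) * DW w m := by
              refine mul_le_mul_of_nonneg_left (Finset.sum_le_sum fun m hm => ?_) hN0.le
              have h1 : DW w m ≤ δ := (Finset.mem_filter.1 hm).2
              have h0 := ((DW w).pos m).le
              calc _ = ((N : ℝ) ^ 2 * Q / τ ^ 2 * DW w m) * DW w m := by ring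
                _ ≤ ((N : ℝ) ^ 2 * Q / τ ^ 2 * DW w m) * δ :=
                  mul_le_mul_of_nonneg_left h1 (by positivity)
                _ = _ := by ring
          _ = (N : ℝ) ^ 3 * Q * δ / τ ^ 2 * ∑ m ∈ F, DW w m := by
              rw [← Finset.mul_sum]
              ring
          _ ≤ (N : ℝ) ^ 3 * Q * δ / τ ^ 2 * (2 * τ) :=
              mul_le_mul_of_nonneg_left hFsum (by positivity)
          _ = 2 / (N : ℝ) ^ 4 := by
              rw [hδ]
              field_simp

/-- Some woman is matched in all stable matchings and has a list in `B`. -/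
theorem listsLaw_matched_inter_le {N : ℕ} (hN : min (Fintype.card M) (Fintype.card W) ≤ N)
    (LM : M → PrefList (Finset.univ : Finset W)) (B : Set (PrefList (Finset.univ : Finset M)))
    {ε : ℝ≥0∞} (hB : ∀ x, ((DW x).listLaw Finset.univ).toOuterMeasure B ≤ ε) :
    listsLaw DW {L | ∃ x, L x ∈ B ∧
      ¬ ∃ η : Matching M W, η.IsStable (LM, L) ∧ η.husband x = none} ≤ ε * N := by
  classical
  set G : W → Set (W → PrefList (Finset.univ : Finset M)) := fun x =>
    {L | ¬ ∃ η : Matching M W, η.IsStable (LM, L) ∧ η.husband x = none} with hG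
  -- A stable matching with `x` single survives any change of her list, so `G x` is independent of
  -- that list.
  have hinv : ∀ x L l, Function.update L x l ∈ G x ↔ L ∈ G x := by
    intro x L l
    refine not_congr (exists_congr fun η => and_congr_left fun hx => ⟨fun h => ?_, fun h => ?_⟩)
    · refine h.congr_of_single rfl fun y hy => ?_
      have hyx : y ≠ x := by rintro rfl; exact hy hx
      simp [Function.update_of_ne hyx]
    · refine h.congr_of_single rfl fun y hy => ?_
      have hyx : y ≠ x := by rintro rfl; exact hy hx
      simp [Function.update_of_ne hyx]
  -- Women who are single in no stable matching are matched in any given one, so there are at most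
  -- `N`. This replaces a union bound over all of `W`.
  have hcount : ∑ x ∈ (Finset.univ : Finset W), listsLaw DW (G x) ≤ (N : ℝ≥0∞) := by
    refine sum_measure_le_of_forall _ fun L => ?_
    obtain ⟨η, hη⟩ := exists_isStable (LM, L)
    set H : Finset W := Finset.univ.filter fun x => η.husband x ≠ none with hH
    have h1 : ∀ x, (G x).indicator (1 : (W → PrefList (Finset.univ : Finset M)) → ℝ≥0∞) L ≤ if x ∈ H then 1 else 0 := by
      intro x
      by_cases hx : L ∈ G x
      · have : x ∈ H := Finset.mem_filter.2 ⟨Finset.mem_univ _, fun h => hx ⟨η, hη, h⟩⟩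
        rw [if_pos this, Set.indicator_of_mem hx, Pi.one_apply]
      · rw [Set.indicator_of_notMem hx]
        exact zero_le
    have h2 : H.card ≤ N := by
      refine le_trans (le_min ?_ (Finset.card_le_univ _)) hN
      have : ∀ x ∈ H, ∃ m, η.husband x = some m := fun x hx =>
        Option.ne_none_iff_exists'.1 (Finset.mem_filter.1 hx).2
      choose! f hf using this
      rw [← Finset.card_univ]
      refine Finset.card_le_card_of_injOn f (fun _ _ => Finset.mem_univ _) fun x hx y hy hxy => ?_
      have h1 := (η.consistent _ _).2 (hf x hx)
      rw [hxy, (η.consistent _ _).2 (hf y hy)] at h1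
      exact (Option.some.inj h1).symm
    calc _ ≤ ∑ x : W, if x ∈ H then (1 : ℝ≥0∞) else 0 := Finset.sum_le_sum fun x _ => h1 x
      _ = H.card := by simp
      _ ≤ N := by exact_mod_cast h2
  calc _ ≤ listsLaw DW (⋃ x ∈ (Finset.univ : Finset W), {L | L x ∈ B ∧ L ∈ G x}) := by
        refine measure_mono ?_
        rintro L ⟨x, hx, hx'⟩
        exact Set.mem_iUnion₂.2 ⟨x, Finset.mem_univ _, hx, hx'⟩
    _ ≤ ∑ x ∈ (Finset.univ : Finset W), listsLaw DW {L | L x ∈ B ∧ L ∈ G x} :=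
        measure_biUnion_finset_le _ _
    _ ≤ ∑ x ∈ (Finset.univ : Finset W), ε * listsLaw DW (G x) := by
        refine Finset.sum_le_sum fun x _ => ?_
        rw [listsLaw_inter_of_update DW x B (G x) (hinv x)]
        exact mul_le_mul_left (hB x) _
    _ ≤ ε * N := by
        rw [← Finset.mul_sum]
        exact mul_le_mul_right hcount _

end WomenSide

/-! ### Combination of both sides -/

section Main

open scoped ENNReal

variable {M W : Type*} [Fintype M] [Fintype W] [DecidableEq M] [DecidableEq W]
  [Nonempty M] [Nonempty W] {DM : M → Popularity W} {DW : W → Popularity M}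

/-- If no woman has an inversion, then it is unlikely that `w` has two stable husbands of very
different popularity, the less popular of them not being negligible. -/
theorem listsLaw_stableHusband_ratio_le {N r : ℕ} (hN2 : 2 ≤ N)
    (hN : N = min (Fintype.card M) (Fintype.card W))
    (hr : 4 * Real.log N * (1 + Real.logb 2 N) / Real.log (1 + 1 / maxRatio DM) < 4 * r + 6)
    {w : W} {T : Finset M} (hT : T.card = N) (htop : IsTopSet (DW w) T) {β c δ : ℝ}
    (hβ : 1 < β) (hc : c ≤ β ^ 3 * δ) {LW : W → PrefList (Finset.univ : Finset M)}
    (hLW : ∀ x, ¬ HasInversion (DW w) β c T (LW x)) :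
    listsLaw DM {L | ∃ m₀ m₁, IsStableHusband (L, LW) w m₀ ∧ IsStableHusband (L, LW) w m₁ ∧
      δ < DW w m₁ ∧ β ^ (4 * r + 3) * DW w m₁ < DW w m₀} ≤ ENNReal.ofReal (1 / (N : ℝ) ^ 2) := by
  classical
  have hβ0 : 0 < β := by linarith
  have hN0 : (0 : ℝ) < N := by
    have : (2 : ℝ) ≤ N := by exact_mod_cast hN2
    linarith
  set S : M → Set (M → PrefList (Finset.univ : Finset W)) := fun m₀ =>
    {L | ∃ m₁, IsStableHusband (L, LW) w m₀ ∧ IsStableHusband (L, LW) w m₁ ∧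
      δ < DW w m₁ ∧ β ^ (4 * r + 3) * DW w m₁ < DW w m₀} with hS
  -- One outcome in `S m₀` supplies a man `m₁'` and a stable matching from which the sizes of the
  -- layers are bounded for all outcomes.
  have key : ∀ m₀, (S m₀).Nonempty →
      m₀ ∈ T ∧ listsLaw DM (S m₀) ≤ ENNReal.ofReal (1 / (N : ℝ) ^ 3) := by
    rintro m₀ ⟨L', m₁', -, ⟨η, hη, hηw⟩, hδ', hlt'⟩
    -- Layers at popularity `D_w(m₀) / β ^ (2 (i-1))`; the condition `0 < i` makes `C 0` empty.
    set C : ℕ → Finset M := fun i =>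
      Finset.univ.filter fun m => 0 < i ∧ DW w m₀ ≤ β ^ (2 * (i - 1)) * DW w m with hC
    have hmem : ∀ i m, m ∈ C i ↔ 0 < i ∧ DW w m₀ ≤ β ^ (2 * (i - 1)) * DW w m := by
      intro i m
      simp [hC]
    have hmono : Monotone C := by
      intro i j hij m hm
      rw [hmem] at hm ⊢
      refine ⟨hm.1.trans_le hij, hm.2.trans (mul_le_mul_of_nonneg_right ?_ ((DW w).pos m).le)⟩
      exact pow_le_pow_right₀ hβ.le (by omega)
    have hup : ∀ i m m', m ∈ C i → DW w m ≤ DW w m' → m' ∈ C i := by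
      intro i m m' hm hle
      rw [hmem] at hm ⊢
      exact ⟨hm.1, hm.2.trans (mul_le_mul_of_nonneg_left hle (by positivity))⟩
    have hnot : ∀ m₁, β ^ (4 * r + 3) * DW w m₁ < DW w m₀ → m₁ ∉ C (2 * r + 2) := by
      intro m₁ hlt hm
      have h1 := ((hmem _ _).1 hm).2
      have h2 : β ^ (2 * (2 * r + 2 - 1)) ≤ β ^ (4 * r + 3) :=
        pow_le_pow_right₀ hβ.le (by omega)
      have := mul_le_mul_of_nonneg_right h2 ((DW w).pos m₁).le
      linarith
    have hlarge : ∀ m ∈ C (2 * r + 1), β ^ 3 * DW w m₁' < DW w m := by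
      intro m hm
      have h1 := ((hmem _ _).1 hm).2
      have h2 : 2 * (2 * r + 1 - 1) = 4 * r := by omega
      rw [h2] at h1
      have h3 : β ^ (4 * r) * (β ^ 3 * DW w m₁') < β ^ (4 * r) * DW w m := by
        calc _ = β ^ (4 * r + 3) * DW w m₁' := by ring
          _ < _ := hlt'.trans_le h1
      exact lt_of_mul_lt_mul_left h3 (by positivity)
    have hcC : ∀ m ∈ C (2 * r + 1), c ≤ DW w m := by
      intro m hm
      have := hlarge m hm
      have h2 := mul_lt_mul_of_pos_left hδ' (pow_pos hβ0 3)
      linarith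
    -- Otherwise the layer contains `T`, and `w` prefers all of `T` to her husband `m₁'`. Then `N <
    -- |W|`, so `N = |M|` and `T` contains `m₁'`, who is outside the layer.
    have hcard : (C (2 * r + 1)).card < N := by
      by_contra! hge
      have hTC : T ⊆ C (2 * r + 1) := by
        intro t ht
        by_contra htC
        obtain ⟨m, hm, hmT⟩ : ∃ m ∈ C (2 * r + 1), m ∉ T := by
          by_contra! hsub
          have := Finset.eq_of_subset_of_card_le hsub (by omega)
          exact htC (this ▸ ht)
        exact htC (hup _ _ _ hm (htop t ht m hmT))
      have hlt := hη.card_lt hηw (S := T) fun m hm => by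
        by_contra hb
        refine hLW w ⟨m, hm, hcC m (hTC hm), m₁', ?_, hb⟩
        have h1 := hlarge m (hTC hm)
        have h2 : β ^ 2 ≤ β ^ 3 := pow_le_pow_right₀ hβ.le (by norm_num)
        have := mul_le_mul_of_nonneg_right h2 ((DW w).pos m₁').le
        linarith
      have huniv : T = Finset.univ := by
        refine Finset.eq_univ_of_card _ ?_
        rcases min_choice (Fintype.card M) (Fintype.card W) with h | h <;> omega
      exact hnot m₁' hlt' (hmono (by omega) (hTC (huniv ▸ Finset.mem_univ _)))
    have hCT : C (2 * r + 1) ⊆ T := by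
      intro m hm
      by_contra hmT
      obtain ⟨t, ht, htC⟩ : ∃ t ∈ T, t ∉ C (2 * r + 1) := by
        by_contra! hsub
        have := Finset.card_le_card hsub
        omega
      exact htC (hup _ _ _ hm (htop t ht m hmT))
    have hm₀ : m₀ ∈ C 1 := by simp [hmem]
    have hdom : ∀ i ≤ 2 * r + 1, Dominates LW (C i) (C (i + 1)) := by
      intro i hi x m hm m' hm'
      by_contra hb
      have hmC := hmono hi hm
      refine hLW x ⟨m, hCT hmC, hcC m hmC, m', ?_, hb⟩
      rw [hmem] at hm hm'
      have h1 : β ^ (2 * (i + 1 - 1)) * DW w m' < DW w m₀ := by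
        by_contra! h
        exact hm' ⟨by omega, h⟩
      have h2 : 2 * (i + 1 - 1) = 2 * (i - 1) + 2 := by omega
      rw [h2] at h1
      have h3 : β ^ (2 * (i - 1)) * (β ^ 2 * DW w m') < β ^ (2 * (i - 1)) * DW w m := by
        calc _ = β ^ (2 * (i - 1) + 2) * DW w m' := by ring
          _ < _ := h1.trans_le hm.2
      exact (lt_of_mul_lt_mul_left h3 (by positivity)).le
    refine ⟨hCT (hmono (by omega) hm₀), ?_⟩
    refine (measure_mono ?_).trans (listsLaw_stableHusband_le (LW := LW) (w := w) hN2
      (hN ▸ min_le_right _ _) hr hmono hcard hdom hm₀)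
    rintro L ⟨m₁, h0, h1, -, hlt⟩
    exact ⟨h0, m₁, hnot m₁ hlt, h1⟩
  calc _ ≤ listsLaw DM (⋃ m₀ ∈ T, S m₀) := by
        refine measure_mono ?_
        rintro L ⟨m₀, m₁, h⟩
        exact Set.mem_iUnion₂.2 ⟨m₀, (key m₀ ⟨L, m₁, h⟩).1, m₁, h⟩
    _ ≤ ∑ m₀ ∈ T, listsLaw DM (S m₀) := measure_biUnion_finset_le _ _
    _ ≤ ∑ _m₀ ∈ T, ENNReal.ofReal (1 / (N : ℝ) ^ 3) := by
        refine Finset.sum_le_sum fun m₀ _ => ?_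
        rcases (S m₀).eq_empty_or_nonempty with h | h
        · rw [h, measure_empty]
          exact zero_le
        · exact (key m₀ h).2
    _ = ENNReal.ofReal (1 / (N : ℝ) ^ 2) := by
        rw [Finset.sum_const, hT, nsmul_eq_mul, ← ENNReal.ofReal_natCast,
          ← ENNReal.ofReal_mul hN0.le]
        congr 1
        field_simp

instance : IsProbabilityMeasure (profileLaw DM DW) :=
  inferInstanceAs (IsProbabilityMeasure ((listsLaw DM).prod (listsLaw DW)))

theorem profileLaw_le_of_sections_fst {s : Set (Profile M W)} {ε : ℝ≥0∞}
    (h : ∀ L, listsLaw DW {L' | (L, L') ∈ s} ≤ ε) : profileLaw DM DW s ≤ ε := by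
  change (listsLaw DM).prod (listsLaw DW) s ≤ ε
  rw [Measure.prod_apply MeasurableSet.of_discrete]
  calc _ ≤ ∫⁻ _, ε ∂listsLaw DM := lintegral_mono h
    _ = ε := by simp

theorem profileLaw_le_of_sections_snd {s : Set (Profile M W)} {ε : ℝ≥0∞}
    (h : ∀ L', listsLaw DM {L | (L, L') ∈ s} ≤ ε) : profileLaw DM DW s ≤ ε := by
  change (listsLaw DM).prod (listsLaw DW) s ≤ ε
  rw [Measure.prod_apply_symm MeasurableSet.of_discrete]
  calc _ ≤ ∫⁻ _, ε ∂listsLaw DW := lintegral_mono h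
    _ = ε := by simp

/-- Three causes of failure: a negligible man ranked high by `w` and another woman (`E₁`), a
necessarily matched woman with an inversion (`E₂`), and bad luck in the men's lists once the
inversions are repaired (`E₃`). -/
theorem profileLaw_stableHusband_ratio_le {N r : ℕ} (hN2 : 2 ≤ N)
    (hN : N = min (Fintype.card M) (Fintype.card W))
    (hr : 4 * Real.log N * (1 + Real.logb 2 N) / Real.log (1 + 1 / maxRatio DM) < 4 * r + 6)
    (w : W) :
    profileLaw DM DW {P | ∃ m₀ m₁, IsStableHusband P w m₀ ∧ IsStableHusband P w m₁ ∧
      ((N : ℝ) ^ 5 * maxCrossRatio DW) ^ (4 * r + 3) * DW w m₁ < DW w m₀} ≤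
      ENNReal.ofReal (2 / (N : ℝ) ^ 2) := by
  classical
  have hNr : (2 : ℝ) ≤ N := by exact_mod_cast hN2
  have hN0 : (0 : ℝ) < N := by linarith
  obtain ⟨T, hT, htop⟩ := exists_isTopSet (DW w) (n := N) (hN ▸ min_le_left _ _)
  set Q := maxCrossRatio DW with hQ
  have hQ1 : 1 ≤ Q := one_le_maxCrossRatio
  set β : ℝ := (N : ℝ) ^ 5 * Q with hβ
  have hβ1 : 1 < β := by
    have : (1 : ℝ) < (N : ℝ) ^ 5 := one_lt_pow₀ (by linarith) (by norm_num)
    nlinarith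
  set τ := ∑ m ∈ Tᶜ, DW w m with hτ
  have hτ0 : 0 ≤ τ := Finset.sum_nonneg fun m _ => ((DW w).pos m).le
  set c := (N : ℝ) ^ 6 * Q * τ with hc
  set δ := τ / ((N : ℝ) ^ 7 * Q) with hδ
  have hcδ : c ≤ β ^ 3 * δ := by
    have h1 : β ^ 3 * δ = (N : ℝ) ^ 2 * Q * c := by
      rw [hβ, hδ, hc]
      field_simp
    have h2 : 1 ≤ (N : ℝ) ^ 2 * Q := one_le_mul_of_one_le_of_one_le (one_le_pow₀ (by linarith)) hQ1
    have h3 : 0 ≤ c := by positivity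
    rw [h1]
    exact le_mul_of_one_le_left h3 h2
  have hinv := fun x => listLaw_hasInversion_le (DW := DW) hN2 hT.le w x
  -- The probability of an inversion is at most `2 / N ^ 5 < 1`.
  have hgood : ∃ l, ¬ HasInversion (DW w) β c T l := by
    by_contra! hall
    have h1 := hinv w
    rw [show {l | HasInversion (DW w) ((N : ℝ) ^ 5 * maxCrossRatio DW)
      ((N : ℝ) ^ 6 * maxCrossRatio DW * ∑ m ∈ Tᶜ, DW w m) T l} = Set.univ from
        Set.eq_univ_of_forall hall,
      ← PMF.toMeasure_apply_eq_toOuterMeasure_apply _ MeasurableSet.univ, measure_univ,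
      ← ENNReal.ofReal_one, ENNReal.ofReal_le_ofReal_iff (by positivity),
      le_div_iff₀ (by positivity)] at h1
    have : (2 : ℝ) ^ 5 ≤ (N : ℝ) ^ 5 := pow_le_pow_left₀ (by norm_num) hNr 5
    linarith
  obtain ⟨l₀, hl₀⟩ := hgood
  -- Outside `E₂` only the lists of women single in all stable matchings change, so stability
  -- persists.
  set repair : (W → PrefList (Finset.univ : Finset M)) → W → PrefList (Finset.univ : Finset M) :=
    fun L x => if HasInversion (DW w) β c T (L x) then l₀ else L x with hrepair
  have hrep : ∀ L x, ¬ HasInversion (DW w) β c T (repair L x) := by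
    intro L x
    by_cases h : HasInversion (DW w) β c T (L x)
    · simpa [hrepair, h] using hl₀
    · simp [hrepair, h]
  set E₁ : Set (Profile M W) := {P | ∃ x ≠ w, ∃ m, DW w m ≤ δ ∧
    (P.2 w).1.idxOf m < N ∧ (P.2 x).1.idxOf m < N} with hE₁
  set E₂ : Set (Profile M W) := {P | ∃ x, HasInversion (DW w) β c T (P.2 x) ∧
    ¬ ∃ η : Matching M W, η.IsStable P ∧ η.husband x = none} with hE₂
  set E₃ : Set (Profile M W) := {P | ∃ m₀ m₁, IsStableHusband (P.1, repair P.2) w m₀ ∧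
    IsStableHusband (P.1, repair P.2) w m₁ ∧ δ < DW w m₁ ∧
    β ^ (4 * r + 3) * DW w m₁ < DW w m₀} with hE₃
  have hN' : ∀ {η : Matching M W} {P : Profile M W} {x m}, T ≠ Finset.univ → η.IsStable P →
      η.husband x = some m → (P.2 x).1.idxOf m < N := by
    intro η P x m hne hη hx
    have h1 := hη.idxOf_lt hx
    have h2 : T.card < Fintype.card M := by
      rw [← Finset.card_univ]
      exact Finset.card_lt_card (Finset.ssubset_univ_iff.2 hne)
    rcases min_choice (Fintype.card M) (Fintype.card W) with h | h <;> omega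
  have hsub : {P : Profile M W | ∃ m₀ m₁, IsStableHusband P w m₀ ∧ IsStableHusband P w m₁ ∧
      β ^ (4 * r + 3) * DW w m₁ < DW w m₀} ⊆ E₁ ∪ E₂ ∪ E₃ := by
    rintro P ⟨m₀, m₁, ⟨η₀, hη₀, hw₀⟩, ⟨η₁, hη₁, hw₁⟩, hlt⟩
    by_cases h2 : P ∈ E₂
    · exact Or.inl (Or.inr h2)
    have hstab : ∀ η : Matching M W, η.IsStable P → η.IsStable (P.1, repair P.2) := by
      intro η hη
      refine hη.congr_of_single rfl fun x hx => ?_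
      have : ¬ HasInversion (DW w) β c T (P.2 x) := fun h =>
        h2 ⟨x, h, fun ⟨η', hη', hx'⟩ => hx (hη'.husband_eq_none hη hx')⟩
      simp [hrepair, this]
    by_cases hδm : δ < DW w m₁
    · exact Or.inr ⟨m₀, m₁, ⟨η₀, hstab _ hη₀, hw₀⟩, ⟨η₁, hstab _ hη₁, hw₁⟩, hδm, hlt⟩
    · left; left
      push Not at hδm
      have huniv : T ≠ Finset.univ := by
        intro h
        have : δ = 0 := by simp [hδ, hτ, h]
        have := (DW w).pos m₁
        linarith
      have hne : m₁ ≠ m₀ := by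
        rintro rfl
        have h1 : 1 ≤ β ^ (4 * r + 3) := one_le_pow₀ hβ1.le
        have := le_mul_of_one_le_left ((DW w).pos m₁).le h1
        linarith
      -- Being matched in `η₁`, the man `m₁` also has a wife `x` in `η₀`, and `x ≠ w`. A stable
      -- husband has rank below `|W| = N`, so both `w` and `x` rank `m₁` high.
      obtain ⟨x, hx⟩ : ∃ x, η₀.wife m₁ = some x := by
        refine Option.ne_none_iff_exists'.1 fun h => ?_
        have h1 := hη₀.wife_eq_none hη₁ h
        rw [(η₁.consistent _ _).2 hw₁] at h1
        exact Option.some_ne_none _ h1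
      have hx' := (η₀.consistent _ _).1 hx
      refine ⟨x, ?_, m₁, hδm, hN' huniv hη₁ hw₁, hN' huniv hη₀ hx'⟩
      rintro rfl
      rw [hw₀] at hx'
      exact hne (Option.some.inj hx').symm
  have hb₁ : profileLaw DM DW E₁ ≤ ENNReal.ofReal (2 / (N : ℝ) ^ 4) := by
    refine profileLaw_le_of_sections_fst fun L => ?_
    refine listsLaw_two_high_ranks_le hN2 hT w htop fun hne => ?_
    have h2 : T.card < Fintype.card M := by
      rw [← Finset.card_univ]
      exact Finset.card_lt_card (Finset.ssubset_univ_iff.2 hne)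
    rcases min_choice (Fintype.card M) (Fintype.card W) with h | h <;> omega
  have hb₂ : profileLaw DM DW E₂ ≤ ENNReal.ofReal (2 / (N : ℝ) ^ 4) := by
    refine profileLaw_le_of_sections_fst fun L => ?_
    refine (listsLaw_matched_inter_le hN.ge L {l | HasInversion (DW w) β c T l} hinv).trans
      (le_of_eq ?_)
    rw [← ENNReal.ofReal_natCast, ← ENNReal.ofReal_mul (by positivity)]
    congr 1
    field_simp
  have hb₃ : profileLaw DM DW E₃ ≤ ENNReal.ofReal (1 / (N : ℝ) ^ 2) :=
    profileLaw_le_of_sections_snd fun L' =>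
      listsLaw_stableHusband_ratio_le hN2 hN hr hT htop hβ1 hcδ (hrep L')
  calc _ ≤ profileLaw DM DW (E₁ ∪ E₂ ∪ E₃) := measure_mono hsub
    _ ≤ profileLaw DM DW E₁ + profileLaw DM DW E₂ + profileLaw DM DW E₃ :=
        (measure_union_le _ _).trans (add_le_add_left (measure_union_le _ _) _)
    _ ≤ ENNReal.ofReal (2 / (N : ℝ) ^ 4) + ENNReal.ofReal (2 / (N : ℝ) ^ 4) +
        ENNReal.ofReal (1 / (N : ℝ) ^ 2) := add_le_add (add_le_add hb₁ hb₂) hb₃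
    _ = ENNReal.ofReal (2 / (N : ℝ) ^ 4 + 2 / (N : ℝ) ^ 4 + 1 / (N : ℝ) ^ 2) := by
        rw [ENNReal.ofReal_add (by positivity) (by positivity),
          ENNReal.ofReal_add (by positivity) (by positivity)]
    _ ≤ _ := by
        refine ENNReal.ofReal_le_ofReal ?_
        have h1 : 2 / (N : ℝ) ^ 4 + 2 / (N : ℝ) ^ 4 ≤ 1 / (N : ℝ) ^ 2 := by
          rw [← add_div, div_le_div_iff₀ (by positivity) (by positivity)]
          have h2 : (2 : ℝ) ^ 2 ≤ (N : ℝ) ^ 2 := pow_le_pow_left₀ (by norm_num) hNr 2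
          nlinarith [pow_pos hN0 2]
        calc _ ≤ 1 / (N : ℝ) ^ 2 + 1 / (N : ℝ) ^ 2 := by linarith
          _ = 2 / (N : ℝ) ^ 2 := by ring

end Main

theorem mainTheorem7 {M W : Type*} [Fintype M] [Fintype W] [DecidableEq M] [DecidableEq W]
    [Nonempty M] [Nonempty W] (DM : M → Popularity W) (DW : W → Popularity M)
    (N : ℕ) (hN : N = min (Fintype.card M) (Fintype.card W)) (w : W) :
    1 - 2 / (N : ℝ) ^ 2 ≤
      (profileLaw DM DW).real {P : Profile M W |
        ∀ m₀ m₁ : M, IsStableHusband P w m₀ → IsStableHusband P w m₁ →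
          DW w m₀ / DW w m₁ ≤
            ((N : ℝ) ^ 5 * maxCrossRatio DW) ^
              (1 + 4 * Real.log N * (1 + Real.logb 2 N) /
                Real.log (1 + 1 / maxRatio DM))} := by
  have hN1 : 1 ≤ N := by
    have h1 : 0 < Fintype.card M := Fintype.card_pos
    have h2 : 0 < Fintype.card W := Fintype.card_pos
    rw [hN, Nat.one_le_iff_ne_zero]
    rcases min_choice (Fintype.card M) (Fintype.card W) with h | h <;> omega
  rcases hN1.eq_or_lt with rfl | hN2
  -- For `N = 1` the claimed probability bound is negative.
  · refine le_trans ?_ measureReal_nonneg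
    norm_num
  have hNr : (2 : ℝ) ≤ N := by exact_mod_cast hN2
  set K := 4 * Real.log N * (1 + Real.logb 2 N) / Real.log (1 + 1 / maxRatio DM) with hK
  set β : ℝ := (N : ℝ) ^ 5 * maxCrossRatio DW with hβ
  have hβ1 : 1 ≤ β := one_le_mul_of_one_le_of_one_le (one_le_pow₀ (by linarith))
    one_le_maxCrossRatio
  have hK2 : 2 ≤ K := by
    have h1 : Real.log 2 ≤ Real.log N := Real.log_le_log (by norm_num) hNr
    have h2 := Real.log_two_gt_d9
    have h3 : 0 ≤ Real.logb 2 N := Real.logb_nonneg (by norm_num) (by linarith)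
    have h4 : 2 ≤ 4 * Real.log N * (1 + Real.logb 2 N) := by nlinarith
    have h5 := inv_log_one_add_ge (one_le_maxRatio (DM := DM)) (by linarith :
      0 ≤ 4 * Real.log N * (1 + Real.logb 2 N))
    have h6 := one_le_maxRatio (DM := DM)
    nlinarith
  -- The largest `r` with `4r + 3 ≤ 1 + K`; maximality gives `K < 4r + 6`.
  set r := ⌊(K - 2) / 4⌋₊ with hr
  have hr1 : (r : ℝ) ≤ (K - 2) / 4 := Nat.floor_le (by linarith)
  have hr2 : (K - 2) / 4 < r + 1 := Nat.lt_floor_add_one _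
  have hbad := profileLaw_stableHusband_ratio_le (DM := DM) (DW := DW) (r := r) hN2 hN
    (by linarith) w
  set G : Set (Profile M W) := {P | ∀ m₀ m₁ : M, IsStableHusband P w m₀ →
    IsStableHusband P w m₁ → DW w m₀ / DW w m₁ ≤ β ^ (1 + K)} with hG
  have hsub : Gᶜ ⊆ {P | ∃ m₀ m₁, IsStableHusband P w m₀ ∧ IsStableHusband P w m₁ ∧
      β ^ (4 * r + 3) * DW w m₁ < DW w m₀} := by
    intro P hP
    simp only [hG, Set.mem_compl_iff, Set.mem_ofPred_eq, not_forall, not_le] at hP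
    obtain ⟨m₀, m₁, h0, h1, hlt⟩ := hP
    refine ⟨m₀, m₁, h0, h1, ?_⟩
    rw [lt_div_iff₀ ((DW w).pos m₁)] at hlt
    refine lt_of_le_of_lt (mul_le_mul_of_nonneg_right ?_ ((DW w).pos m₁).le) hlt
    rw [← Real.rpow_natCast]
    refine Real.rpow_le_rpow_of_exponent_le hβ1 ?_
    push_cast
    linarith
  have h1 : (profileLaw DM DW).real Gᶜ ≤ 2 / (N : ℝ) ^ 2 :=
    ENNReal.toReal_le_of_le_ofReal (by positivity) ((measure_mono hsub).trans hbad)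
  rw [probReal_compl_eq_one_sub MeasurableSet.of_discrete] at h1
  linarith
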